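/- Definitions. Let $G$ be a finite connected graph. A set $S\subseteq V(G)$ is a mutual-visibility set if for all $x,y\in S$ there is a shortest $x$–$y$ path with no internal vertex in $S$. The mutual-visibility chromatic number $\chi_\mu(G)$ is the smallest number of colors in a coloring of $V(G)$ in which every color class is a mutual-visibility set. For $t\ge 2$ and $r\ge 1$, the perfect $t$-ary tree $T_{r,t}$ is the rooted tree in which every non-leaf vertex has exactly $t$ children and every leaf has depth $r$. The glued $t$-ary tree $GT(r,t)$ is obtained from two copies of $T_{r,t}$ by identifying each leaf of the first copy with the corresponding leaf of the second copy. Theorem. Let $r,t\ge 2$ and $i\ge 1$ be integers. Then $$\chi_\mu(GT(r,t))=\begin{cases}2(r-i)+3, & \text{if } \dfrac{t^{i-1}-1}{t-1}+i-1\le r\le \dfrac{t^{i-1}-1}{t-1}+\dfrac{t^{i-1}}{2}+i-2,\\[2ex] 2(r-i)+2, & \text{if } \dfrac{t^{i-1}-1}{t-1}+\dfrac{t^{i-1}}{2}+i-1\le r\le \dfrac{t^{i}-1}{t-1}+i-1.\end{cases}$$ Here the bounds on $r$ are inequalities between real numbers (for odd $t$ the number $t^{i-1}/2$ is not an integer;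 no value is asserted for an $r$ that satisfies neither condition for any $i$). -/

import Mathlib

/-- `S` is a mutual-visibility set of `G`: any two vertices of `S` are joined by a shortest path
none of whose internal vertices lies in `S`. -/
def IsMutualVisibilitySet {V : Type*} (G : SimpleGraph V) (S : Set V) : Prop :=
  ∀ x ∈ S, ∀ y ∈ S, ∃ p : G.Walk x y, p.length = G.dist x y ∧
    ∀ z ∈ p.support, z ∈ S → z = x ∨ z = y

/-- The vertices of `G` can be coloured with (at most) `k` colours so that every colour class is a
mutual-visibility set. -/
def MutualVisibilityColorable {V : Type*} (G : SimpleGraph V) (k : ℕ) : Prop :=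
  ∃ c : V → Fin k, ∀ a : Fin k, IsMutualVisibilitySet G {v | c v = a}

/-- The mutual-visibility chromatic number of a finite graph: the smallest number of colours in a
mutual-visibility colouring. -/
noncomputable def mutualVisibilityChromaticNumber {V : Type*} [Finite V] (G : SimpleGraph V) : ℕ :=
  sInf {k : ℕ | MutualVisibilityColorable G k}

/-- Vertices of the perfect `t`-ary tree of depth `r`: words of length at most `r` over `Fin t`.
The empty word is the root, the depth of a vertex is its length, the children of `w` are the words
`j :: w` with `j : Fin t`, and the leaves are the words of length `r`. -/
abbrev PerfectTreeVertex (r t : ℕ) : Type := {w : List (Fin t) // w.length ≤ r}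

/-- The perfect `t`-ary tree `T_{r,t}` of depth `r`. -/
def perfectTree (r t : ℕ) : SimpleGraph (PerfectTreeVertex r t) where
  Adj u v := (∃ j : Fin t, v.1 = j :: u.1) ∨ (∃ j : Fin t, u.1 = j :: v.1)
  symm := ⟨fun _ _ h => h.symm⟩
  loopless := ⟨fun u h => by simp at h⟩

/-- On two copies (indexed by `Bool`) of the perfect tree, each leaf of one copy is identified
with the corresponding leaf of the other copy. -/
def gluedTreeSetoid (r t : ℕ) : Setoid (Bool × PerfectTreeVertex r t) where
  r x y := x.2 = y.2 ∧ (x.1 = y.1 ∨ x.2.1.length = r)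
  iseqv :=
    { refl := fun _ => ⟨rfl, Or.inl rfl⟩
      symm := by
        rintro ⟨b, u⟩ ⟨c, v⟩ ⟨h, h'⟩
        dsimp only at h h' ⊢
        subst h
        exact ⟨rfl, h'.imp Eq.symm id⟩
      trans := by
        rintro ⟨b, u⟩ ⟨c, v⟩ ⟨d, w⟩ ⟨h, h'⟩ ⟨k, k'⟩
        dsimp only at h h' k k' ⊢
        subst h
        subst k
        refine ⟨rfl, ?_⟩
        rcases h' with h' | h'
        · rcases k' with k' | k'
          · exact Or.inl (h'.trans k')
          · exact Or.inr k'
        · exact Or.inr h' }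

/-- Vertices of the glued `t`-ary tree. -/
abbrev GluedTreeVertex (r t : ℕ) : Type := Quotient (gluedTreeSetoid r t)

instance perfectTreeVertexFinite (r t : ℕ) : Finite (PerfectTreeVertex r t) :=
  (List.finite_length_le (Fin t) r).to_subtype

/-- The glued `t`-ary tree `GT(r,t)`: the two copies of the perfect tree with their leaves pairwise
identified; the edges are the images of the edges of the two copies. -/
def gluedTree (r t : ℕ) : SimpleGraph (GluedTreeVertex r t) where
  Adj x y := ∃ (b : Bool) (u v : PerfectTreeVertex r t), (perfectTree r t).Adj u v ∧
    x = Quotient.mk (gluedTreeSetoid r t) (b, u) ∧ y = Quotient.mk (gluedTreeSetoid r t) (b, v)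
  symm := ⟨fun _ _ ⟨b, u, v, h, hx, hy⟩ => ⟨b, v, u, h.symm, hy, hx⟩⟩
  loopless := ⟨fun _ ⟨_, _, _, h, hx, hy⟩ =>
    h.ne (Quotient.exact (s := gluedTreeSetoid r t) (hx.symm.trans hy)).1⟩

-- Vertices are words with a copy index, so "above" means "is a suffix of". With k = i - 1 and T the
-- number of words shorter than k, the claim is that 2(r-k)+1 colours are optimal in the first range
-- and 2(r-k) in the second.
--
-- Lower bound. A shortest path between x and y climbs to the longest common suffix of their words
-- in one of the two copies, and in that copy it passes through every vertex in between
-- (`exists_side`). Hence a mutual-visibility set has few comparable pairs. Either one vertex meets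
-- all of them (`exists_star`), or the set contains a triple x above x' in one copy with y above or
-- level with x' in the other, and then almost everything lies below a single child
-- (`IsTriple.exists_child`). Give a vertex of depth d the weight t^(r - max(d, k)). An antichain of
-- words weighs at most t^r, by counting leaves, and one extra vertex adds at most t^(r-k). So every
-- class weighs at most t^r + t^(r-k) (`sum_weight_le`), and comparison with the total weight gives
-- `le_of_colorable`.
--
-- Upper bound. A full level of one copy stays a mutual-visibility set when one shallower vertex of
-- the other copy is added. The levels of depth at least k form 2(r-k)+1 classes, which absorb the
-- 2T shallower vertices if T ≤ r - k. One class is saved by replacing the two levels of depth k by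
-- a single class of t^k + 1 vertices and letting the deeper levels absorb the other t^k - 1
-- vertices of depth k.

namespace GluedTree

open SimpleGraph

variable {r t : ℕ} {S : Set (GluedTreeVertex r t)}

-- Coordinates on the glued tree: words, copies and levels.

/-- The word underlying a vertex of the glued tree. -/
def word : GluedTreeVertex r t → List (Fin t) :=
  Quotient.lift (fun x => x.2.1) fun _ _ h => congrArg Subtype.val h.1

/-- The distance of a vertex from the root of the copy `b`. -/
def lev (b : Bool) : GluedTreeVertex r t → ℕ :=
  Quotient.lift (fun x => if b = x.1 then x.2.1.length else 2 * r - x.2.1.length) (by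
    rintro ⟨c, u⟩ ⟨d, v⟩ ⟨h, h'⟩
    dsimp only at h h' ⊢
    subst h
    rcases h' with h' | h'
    · rw [h']
    · split_ifs <;> omega)

/-- The vertex of the copy `b` with word `w`; words that are too long are truncated. -/
def node (r : ℕ) (b : Bool) (w : List (Fin t)) : GluedTreeVertex r t :=
  Quotient.mk _ (b, ⟨w.drop (w.length - r), by rw [List.length_drop]; omega⟩)

theorem node_of_le {b : Bool} {w : List (Fin t)} (hw : w.length ≤ r) :
    node r b w = Quotient.mk (gluedTreeSetoid r t) (b, ⟨w, hw⟩) := by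
  have h : w.drop (w.length - r) = w := by rw [Nat.sub_eq_zero_of_le hw, List.drop_zero]
  simp only [node, h]

theorem word_node {b : Bool} {w : List (Fin t)} (hw : w.length ≤ r) : word (node r b w) = w := by
  rw [node_of_le hw]; rfl

theorem lev_node {b c : Bool} {w : List (Fin t)} (hw : w.length ≤ r) :
    lev b (node r c w) = if b = c then w.length else 2 * r - w.length := by
  rw [node_of_le hw]; rfl

theorem length_word_le (v : GluedTreeVertex r t) : (word v).length ≤ r := by
  induction v using Quotient.inductionOn with
  | h a => exact a.2.2

theorem exists_eq_node (v : GluedTreeVertex r t) : ∃ b, v = node r b (word v) := by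
  induction v using Quotient.inductionOn with
  | h a => exact ⟨a.1, (node_of_le a.2.2).symm⟩

theorem node_eq_node_of_length_eq (b c : Bool) {w : List (Fin t)} (hw : w.length = r) :
    node r b w = node r c w := by
  rw [node_of_le hw.le, node_of_le hw.le]
  exact Quotient.sound ⟨rfl, Or.inr hw⟩

theorem eq_of_node_eq_node {b c : Bool} {v w : List (Fin t)} (hv : v.length ≤ r)
    (hw : w.length ≤ r) (h : node r b v = node r c w) : v = w ∧ (b = c ∨ w.length = r) := by
  rw [node_of_le hv, node_of_le hw] at h
  obtain ⟨h₁, h₂⟩ := Quotient.exact h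
  have h₁ : v = w := congrArg Subtype.val h₁
  refine ⟨h₁, h₂.imp id fun h => ?_⟩
  exact h₁ ▸ h

theorem adj_iff {x y : GluedTreeVertex r t} : (gluedTree r t).Adj x y ↔
    ∃ b w j, (j :: w).length ≤ r ∧ ((x = node r b w ∧ y = node r b (j :: w)) ∨
      (x = node r b (j :: w) ∧ y = node r b w)) := by
  constructor
  · rintro ⟨b, ⟨u, hu⟩, ⟨v, hv⟩, h, rfl, rfl⟩
    rcases h with ⟨j, h⟩ | ⟨j, h⟩
    · dsimp only at h
      subst h
      exact ⟨b, u, j, hv, Or.inl ⟨(node_of_le hu).symm, (node_of_le hv).symm⟩⟩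
    · dsimp only at h
      subst h
      exact ⟨b, v, j, hu, Or.inr ⟨(node_of_le hu).symm, (node_of_le hv).symm⟩⟩
  · rintro ⟨b, w, j, hw, ⟨rfl, rfl⟩ | ⟨rfl, rfl⟩⟩
    · have hw' : w.length ≤ r := (Nat.le_succ _).trans hw
      exact ⟨b, ⟨w, hw'⟩, ⟨_, hw⟩, Or.inl ⟨j, rfl⟩, node_of_le hw', node_of_le hw⟩
    · have hw' : w.length ≤ r := (Nat.le_succ _).trans hw
      exact ⟨b, ⟨_, hw⟩, ⟨w, hw'⟩, Or.inr ⟨j, rfl⟩, node_of_le hw, node_of_le hw'⟩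

theorem lev_le_of_adj {x y : GluedTreeVertex r t} (b : Bool) (h : (gluedTree r t).Adj x y) :
    lev b x ≤ lev b y + 1 := by
  obtain ⟨c, w, j, hw, ⟨rfl, rfl⟩ | ⟨rfl, rfl⟩⟩ := adj_iff.1 h <;>
  · have hw' : w.length ≤ r := (Nat.le_succ _).trans hw
    rw [lev_node hw, lev_node hw']
    rw [List.length_cons] at *
    split_ifs <;> omega

theorem lev_le_of_walk (b : Bool) {x y : GluedTreeVertex r t} (p : (gluedTree r t).Walk x y) :
    lev b x ≤ lev b y + p.length := by
  induction p with
  | nil => simp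
  | cons h p ih =>
    have := lev_le_of_adj b h
    rw [Walk.length_cons]
    omega

theorem lev_le_of_walk' (b : Bool) {x y : GluedTreeVertex r t} (p : (gluedTree r t).Walk x y) :
    lev b y ≤ lev b x + p.length := by
  simpa using lev_le_of_walk b p.reverse

-- Walks and the tree of words.

/-- A walk leaving the subtree of words ending in `s` does so through one of the two vertices with
word `s`. -/
theorem exists_crossing {x y : GluedTreeVertex r t} (p : (gluedTree r t).Walk x y)
    {s : List (Fin t)} (hx : s <:+ word x) (hy : ¬ s <:+ word y) :
    ∃ b j w, s = j :: w ∧ s.length ≤ r ∧ node r b s ∈ p.support ∧ node r b w ∈ p.support := by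
  obtain ⟨d, hd, h₁, h₂⟩ := p.exists_boundary_dart {v | s <:+ word v} hx hy
  have m₁ := p.dart_fst_mem_support_of_mem_darts hd
  have m₂ := p.dart_snd_mem_support_of_mem_darts hd
  obtain ⟨b, w, j, hw, ⟨e₁, e₂⟩ | ⟨e₁, e₂⟩⟩ := adj_iff.1 d.adj
  all_goals
    have hw' : w.length ≤ r := (Nat.le_succ _).trans hw
    rw [Set.mem_ofPred_eq, e₁] at h₁
    rw [Set.mem_ofPred_eq, e₂] at h₂
    rw [word_node ‹_›] at h₁ h₂
    rw [e₁] at m₁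
    rw [e₂] at m₂
  · exact absurd (h₁.trans (List.suffix_cons j w)) h₂
  · rcases List.suffix_cons_iff.1 h₁ with h | h
    · exact ⟨b, j, w, h, h ▸ hw, h ▸ m₁, m₂⟩
    · exact absurd h h₂

/-- Every two words have a longest common suffix. -/
theorem exists_longest_common_suffix {α : Type*} (u v : List α) :
    ∃ d, d <:+ u ∧ d <:+ v ∧ ∀ a, a <:+ u → a <:+ v → a <:+ d := by
  induction u with
  | nil => exact ⟨[], List.suffix_rfl, List.nil_suffix, fun a h _ => h⟩
  | cons j u ih =>
    by_cases h : (j :: u) <:+ v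
    · exact ⟨_, List.suffix_rfl, h, fun a ha _ => ha⟩
    · obtain ⟨d, h₁, h₂, h₃⟩ := ih
      refine ⟨d, h₁.trans (List.suffix_cons j u), h₂, fun a ha hav => ?_⟩
      rcases List.suffix_cons_iff.1 ha with rfl | ha
      · exact absurd hav h
      · exact h₃ a ha hav

theorem exists_cons_suffix {α : Type*} {d u : List α} (h : d <:+ u) (hne : d ≠ u) :
    ∃ j, (j :: d) <:+ u := by
  obtain ⟨l, rfl⟩ := h
  rcases List.eq_nil_or_concat l with rfl | ⟨l', j, rfl⟩
  · simp at hne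
  · exact ⟨j, l', by simp⟩

/-- A walk visits a vertex whose word is the longest common suffix of the words of its ends. -/
theorem exists_node_mem_support {x y : GluedTreeVertex r t} (p : (gluedTree r t).Walk x y)
    {d : List (Fin t)} (hx : d <:+ word x)
    (hd : ∀ a, a <:+ word x → a <:+ word y → a <:+ d) :
    ∃ b, node r b d ∈ p.support := by
  by_cases h : d = word x
  · obtain ⟨b, hb⟩ := exists_eq_node x
    refine ⟨b, ?_⟩
    rw [h, ← hb]
    exact p.start_mem_support
  · obtain ⟨j, hj⟩ := exists_cons_suffix hx h
    obtain ⟨b, j', w, e, -, -, h₂⟩ := exists_crossing p hj fun h' => by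
      have := (hd _ hj h').length_le
      simp at this
    obtain ⟨-, rfl⟩ := List.cons.inj e
    exact ⟨b, h₂⟩

theorem exists_split_of_mem_support {x y z : GluedTreeVertex r t}
    (p : (gluedTree r t).Walk x y) (hz : z ∈ p.support) :
    ∃ (p₁ : (gluedTree r t).Walk x z) (p₂ : (gluedTree r t).Walk z y),
      p₁.length + p₂.length = p.length ∧ ∀ v, v ∈ p₁.support ∨ v ∈ p₂.support → v ∈ p.support := by
  classical
  refine ⟨p.takeUntil z hz, p.dropUntil z hz, ?_, fun v hv => ?_⟩
  · rw [← Walk.length_append, Walk.take_spec]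
  · rwa [← Walk.mem_support_append_iff, Walk.take_spec] at hv

/-- A walk from `node e d` of the least possible length to a vertex below passes through all
vertices of the copy `e` in between. -/
theorem node_mem_support_of_tight {e : Bool} {d : List (Fin t)} {x : GluedTreeVertex r t}
    (p : (gluedTree r t).Walk (node r e d) x) (hd : d <:+ word x)
    (hp : p.length + d.length ≤ lev e x) {s : List (Fin t)} (h₁ : d <:+ s) (h₂ : s <:+ word x) :
    node r e s ∈ p.support := by
  by_cases hs : d = s
  · subst hs; exact p.start_mem_support
  have hx := length_word_le x
  have hdr : d.length ≤ r := hd.length_le.trans hx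
  have hsr : s.length ≤ r := h₂.length_le.trans hx
  obtain ⟨b, j, w, rfl, -, m₁, m₂⟩ := exists_crossing p.reverse h₂ (by
    rw [word_node hdr]
    intro h
    exact hs (h₁.eq_of_length_le h.length_le))
  rw [Walk.support_reverse, List.mem_reverse] at m₁ m₂
  by_cases hb : e = b
  · subst hb; exact m₁
  -- A crossing in the other copy visits its vertex with word `w`, whose level seen from copy `e`
  -- exceeds that of `x`, so the walk would be too long.
  have hwr : w.length ≤ r := (Nat.le_succ _).trans hsr
  obtain ⟨p₁, p₂, hl, -⟩ := exists_split_of_mem_support p m₂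
  have k₁ := lev_le_of_walk' e p₁
  have k₂ := lev_le_of_walk e p₂
  obtain ⟨c, hc⟩ := exists_eq_node x
  have k₃ : lev e x = if e = c then (word x).length else 2 * r - (word x).length := by
    conv_lhs => rw [hc]
    exact lev_node hx
  rw [lev_node hwr, if_neg hb] at k₁ k₂
  rw [lev_node hdr, if_pos rfl] at k₁
  have := h₂.length_le
  rw [List.length_cons] at this hsr
  split_ifs at k₃ <;> omega

/-- The vertices of a copy between a vertex and a vertex below it form a path. -/
theorem exists_walk_down (e : Bool) {d w : List (Fin t)} (h : d <:+ w) (hw : w.length ≤ r) :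
    ∃ p : (gluedTree r t).Walk (node r e d) (node r e w), p.length + d.length = w.length ∧
      ∀ z ∈ p.support, ∃ s, z = node r e s ∧ d <:+ s ∧ s <:+ w := by
  induction w with
  | nil =>
    obtain rfl := List.suffix_nil.1 h
    exact ⟨Walk.nil, by simp, fun z hz => ⟨[], by simpa using hz, h, h⟩⟩
  | cons j w ih =>
    rcases List.suffix_cons_iff.1 h with rfl | h'
    · exact ⟨Walk.nil, by simp, fun z hz => ⟨j :: w, by simpa using hz, h, h⟩⟩
    · obtain ⟨p, hp, hs⟩ := ih h' ((Nat.le_succ _).trans hw)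
      refine ⟨p.concat (adj_iff.2 ⟨e, w, j, hw, Or.inl ⟨rfl, rfl⟩⟩), ?_, fun z hz => ?_⟩
      · rw [Walk.length_concat, List.length_cons]; omega
      · rw [Walk.support_concat, List.mem_append, List.mem_singleton] at hz
        rcases hz with hz | rfl
        · obtain ⟨s, h₁, h₂, h₃⟩ := hs z hz
          exact ⟨s, h₁, h₂, h₃.trans (List.suffix_cons j w)⟩
        · exact ⟨_, rfl, h, List.suffix_rfl⟩

theorem exists_suffix_length_eq (ht : 0 < t) {w : List (Fin t)} (hw : w.length ≤ r) :
    ∃ l : List (Fin t), w <:+ l ∧ l.length = r :=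
  ⟨List.replicate (r - w.length) ⟨0, ht⟩ ++ w, List.suffix_append _ _, by simp; omega⟩

/-- A path from `node e d` through the leaf `l` to `node (!e) v`. -/
theorem exists_walk_across (e : Bool) {d v l : List (Fin t)} (hd : d <:+ l) (hv : v <:+ l)
    (hl : l.length = r) :
    ∃ p : (gluedTree r t).Walk (node r e d) (node r (!e) v),
      p.length + d.length + v.length = 2 * r ∧
      ∀ z ∈ p.support, (∃ s, z = node r e s ∧ d <:+ s ∧ s <:+ l) ∨
        ∃ s, z = node r (!e) s ∧ v <:+ s ∧ s <:+ l := by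
  obtain ⟨p, hp, sp⟩ := exists_walk_down (r := r) e hd hl.le
  obtain ⟨q, hq, sq⟩ := exists_walk_down (r := r) (!e) hv hl.le
  have h := node_eq_node_of_length_eq e (!e) hl
  refine ⟨(p.copy rfl h).append q.reverse, ?_, fun z hz => ?_⟩
  · rw [Walk.length_append, Walk.length_copy, Walk.length_reverse]; omega
  · rw [Walk.mem_support_append_iff, Walk.support_copy, Walk.support_reverse,
      List.mem_reverse] at hz
    exact hz.imp (sp z) (sq z)

/-- With `lev_le_of_walk'` this makes `lev e x - d.length` the exact distance. -/
theorem dist_node_le (ht : 0 < t) (e : Bool) {d : List (Fin t)} {x : GluedTreeVertex r t}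
    (hd : d <:+ word x) :
    ∃ p : (gluedTree r t).Walk (node r e d) x, p.length + d.length = lev e x := by
  have hx := length_word_le x
  obtain ⟨c, hc⟩ := exists_eq_node x
  have k₃ : lev e x = if e = c then (word x).length else 2 * r - (word x).length := by
    conv_lhs => rw [hc]
    exact lev_node hx
  by_cases h : e = c
  · subst h
    obtain ⟨p, hp, -⟩ := exists_walk_down (r := r) e hd hx
    refine ⟨p.copy rfl hc.symm, ?_⟩
    rw [Walk.length_copy, k₃, if_pos rfl, hp]
  · obtain ⟨l, h₁, h₂⟩ := exists_suffix_length_eq ht hx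
    obtain ⟨p, hp, -⟩ := exists_walk_across e (hd.trans h₁) h₁ h₂
    obtain rfl : c = !e := by cases c <;> cases e <;> first | rfl | exact absurd rfl h
    refine ⟨p.copy rfl hc.symm, ?_⟩
    rw [Walk.length_copy, k₃, if_neg h]
    omega

-- Obstructions to mutual visibility.

/-- A shortest path from a vertex of copy `b` to one below it, in either copy, is forced through all
vertices of copy `b` in between. So a member of `S` there must be the lower end. -/
theorem eq_of_between (ht : 0 < t) (hS : IsMutualVisibilitySet (gluedTree r t) S) {b c : Bool}
    {u v s : List (Fin t)} (hu : node r b u ∈ S) (hv : node r c v ∈ S) (hvr : v.length ≤ r)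
    (h₁ : u <:+ s) (hne : u ≠ s) (h₂ : s <:+ v) (hs : node r b s ∈ S) :
    node r b s = node r c v := by
  obtain ⟨p, hp, hp'⟩ := hS _ hu _ hv
  have hw : word (node r c v) = v := word_node hvr
  obtain ⟨q, hq⟩ := dist_node_le ht b (x := node r c v) (d := u) (by rw [hw]; exact h₁.trans h₂)
  have := dist_le q
  have hm := node_mem_support_of_tight p (by rw [hw]; exact h₁.trans h₂) (by omega) h₁
    (by rw [hw]; exact h₂)
  refine (hp' _ hm hs).resolve_left fun h => hne ?_
  exact (eq_of_node_eq_node (h₂.length_le.trans hvr)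
    ((h₁.trans h₂).length_le.trans hvr) h).1.symm

/-- The word `s` lies on the path from `u` to `v` in the tree of words. -/
def Between (s u v : List (Fin t)) : Prop :=
  (s <:+ u ∨ s <:+ v) ∧ ∀ a, a <:+ u → a <:+ v → a <:+ s

theorem Between.symm {s u v : List (Fin t)} (h : Between s u v) : Between s v u :=
  ⟨h.1.symm, fun a h₁ h₂ => h.2 a h₂ h₁⟩

/-- A suffix `s` of `v` is on the path from `u` to `v` unless the path turns below `s`. -/
theorem between_of_not_suffix {s u v : List (Fin t)} (hs : s <:+ v) (hu : ¬ s <:+ u) :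
    Between s u v := by
  refine ⟨Or.inr hs, fun a h₁ h₂ => ?_⟩
  exact (List.suffix_or_suffix_of_suffix h₂ hs).resolve_right fun h => hu (h.trans h₁)

/-- The copy `e` is the one in which a visible shortest path turns. It minimises the sum of levels,
and both halves of the path are then tight. -/
theorem exists_side (ht : 0 < t) (hS : IsMutualVisibilitySet (gluedTree r t) S)
    {x y : GluedTreeVertex r t} (hx : x ∈ S) (hy : y ∈ S) :
    ∃ e, lev e x + lev e y ≤ lev (!e) x + lev (!e) y ∧
      ∀ s, Between s (word x) (word y) → node r e s ∈ S → node r e s = x ∨ node r e s = y := by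
  obtain ⟨p, hp, hp'⟩ := hS _ hx _ hy
  obtain ⟨d, h₁, h₂, h₃⟩ := exists_longest_common_suffix (word x) (word y)
  obtain ⟨e, he⟩ := exists_node_mem_support p h₁ h₃
  have hdr : d.length ≤ r := h₁.length_le.trans (length_word_le x)
  obtain ⟨p₁, p₂, hl, hsup⟩ := exists_split_of_mem_support p he
  have k₁ := lev_le_of_walk e p₁
  have k₂ := lev_le_of_walk' e p₂
  rw [lev_node hdr, if_pos rfl] at k₁ k₂
  -- Turning in either copy gives a competing walk. Applied to `e`, this makes both halves of `p`
  -- tight; applied to `!e`, it gives the inequality of levels.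
  have key : ∀ e', p.length + d.length + d.length ≤ lev e' x + lev e' y := fun e' => by
    obtain ⟨q₁, hq₁⟩ := dist_node_le ht e' h₁
    obtain ⟨q₂, hq₂⟩ := dist_node_le ht e' h₂
    have := dist_le (q₁.reverse.append q₂)
    rw [Walk.length_append, Walk.length_reverse] at this
    omega
  have := key e
  have := key (!e)
  refine ⟨e, by omega, fun s hs hsS => hp' _ (hsup _ ?_) hsS⟩
  have hds := hs.2 d h₁ h₂
  rcases hs.1 with h | h
  · left
    have := node_mem_support_of_tight p₁.reverse h₁ (by rw [Walk.length_reverse]; omega) hds h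
    rwa [Walk.support_reverse, List.mem_reverse] at this
  · right
    exact node_mem_support_of_tight p₂ h₂ (by omega) hds h

theorem exists_side_node (ht : 0 < t) (hS : IsMutualVisibilitySet (gluedTree r t) S) {b c : Bool}
    {u v : List (Fin t)} (hu : node r b u ∈ S) (hv : node r c v ∈ S) (hur : u.length ≤ r)
    (hvr : v.length ≤ r) :
    ∃ e, lev e (node r b u) + lev e (node r c v) ≤ lev (!e) (node r b u) + lev (!e) (node r c v) ∧
      ∀ s, Between s u v → node r e s ∈ S → node r e s = node r b u ∨ node r e s = node r c v := by
  simpa only [word_node hur, word_node hvr] using exists_side ht hS hu hv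

/-- Since `u` is not a leaf, turning in the other copy is strictly longer. -/
theorem same_side (ht : 0 < t) (hS : IsMutualVisibilitySet (gluedTree r t) S) {b : Bool}
    {u v s : List (Fin t)} (hu : node r b u ∈ S) (hv : node r b v ∈ S) (hur : u.length < r)
    (hvr : v.length ≤ r) (hs : Between s u v) (hsS : node r b s ∈ S) :
    node r b s = node r b u ∨ node r b s = node r b v := by
  obtain ⟨e, h₁, h₂⟩ := exists_side_node ht hS hu hv hur.le hvr
  have : e = b := by
    by_contra hne
    rw [lev_node hur.le, lev_node hur.le, lev_node hvr, lev_node hvr, if_neg hne, if_neg hne,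
      if_pos (by cases e <;> cases b <;> simp_all), if_pos (by cases e <;> cases b <;> simp_all)]
      at h₁
    omega
  subst this
  exact h₂ s hs hsS

/-- The path turns in the copy of the end of smaller depth. -/
theorem opposite_sides (ht : 0 < t) (hS : IsMutualVisibilitySet (gluedTree r t) S) {b : Bool}
    {u v : List (Fin t)} (hu : node r b u ∈ S) (hv : node r (!b) v ∈ S) (hur : u.length ≤ r)
    (hvr : v.length ≤ r) :
    (u.length ≤ v.length ∧ ∀ s, Between s u v → node r b s ∈ S →
      node r b s = node r b u ∨ node r b s = node r (!b) v) ∨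
    (v.length ≤ u.length ∧ ∀ s, Between s u v → node r (!b) s ∈ S →
      node r (!b) s = node r b u ∨ node r (!b) s = node r (!b) v) := by
  obtain ⟨e, h₁, h₂⟩ := exists_side_node ht hS hu hv hur hvr
  rw [lev_node hur, lev_node hur, lev_node hvr, lev_node hvr] at h₁
  by_cases he : e = b
  · subst he
    refine Or.inl ⟨?_, h₂⟩
    simp at h₁
    omega
  · obtain rfl : e = !b := by cases e <;> cases b <;> first | rfl | exact absurd rfl he
    refine Or.inr ⟨?_, h₂⟩
    simp at h₁
    omega

/-- At most two vertices of one copy lie on a path from the root to a leaf. -/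
theorem not_three_on_side (ht : 0 < t) (hS : IsMutualVisibilitySet (gluedTree r t) S) {b : Bool}
    {u v w l : List (Fin t)} (hl : l.length ≤ r) (hu : node r b u ∈ S) (hv : node r b v ∈ S)
    (hw : node r b w ∈ S) (ul : u <:+ l) (vl : v <:+ l) (wl : w <:+ l) (h₁ : u ≠ v) (h₂ : u ≠ w)
    (h₃ : v ≠ w) : False := by
  have key : ∀ {u v w : List (Fin t)}, node r b u ∈ S → node r b v ∈ S → node r b w ∈ S →
      w <:+ l → u ≠ v → v ≠ w → u <:+ v → v <:+ w → False := by
    intro u v w hu hv hw wl h₁ h₂ huv hvw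
    have hwr := wl.length_le.trans hl
    exact h₂ (eq_of_node_eq_node (hvw.length_le.trans hwr) hwr
      (eq_of_between ht hS hu hw hwr huv h₁ hvw hv)).1
  rcases List.suffix_or_suffix_of_suffix ul vl with a | a <;>
  rcases List.suffix_or_suffix_of_suffix ul wl with c | c <;>
  rcases List.suffix_or_suffix_of_suffix vl wl with d | d
  · exact key hu hv hw wl h₁ h₃ a d
  · exact key hu hw hv vl h₂ h₃.symm c d
  · exact key hu hv hw wl h₁ h₃ a d
  · exact key hw hu hv vl h₂.symm h₁ c a
  · exact key hv hu hw wl h₁.symm h₂ a c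
  · exact key hu hw hv vl h₂ h₃.symm c d
  · exact key hv hw hu ul h₃ h₂.symm d c
  · exact key hw hv hu ul h₃.symm h₁.symm d a

/-- The lower vertices of the two pairs have comparable words. The shallower of them then blocks the
view from its upper partner to the other lower vertex. -/
theorem not_two_and_two (ht : 0 < t) (hS : IsMutualVisibilitySet (gluedTree r t) S) {b : Bool}
    {u v x y l : List (Fin t)} (hl : l.length ≤ r) (hu : node r b u ∈ S) (hv : node r b v ∈ S)
    (hx : node r (!b) x ∈ S) (hy : node r (!b) y ∈ S) (ul : u <:+ l) (vl : v <:+ l) (xl : x <:+ l)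
    (yl : y <:+ l) (h₁ : u ≠ v) (h₂ : x ≠ y) (h₃ : node r b u ≠ node r (!b) x)
    (h₄ : node r b u ≠ node r (!b) y) (h₅ : node r b v ≠ node r (!b) x)
    (h₆ : node r b v ≠ node r (!b) y) : False := by
  have key : ∀ {u v x y : List (Fin t)}, node r b u ∈ S → node r b v ∈ S →
      node r (!b) x ∈ S → node r (!b) y ∈ S → u <:+ v → u ≠ v → x <:+ y → x ≠ y → v <:+ l →
      y <:+ l → node r b v ≠ node r (!b) y → False := by
    intro u v x y hu hv hx hy huv h₁ hxy h₂ vl yl h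
    rcases List.suffix_or_suffix_of_suffix vl yl with hvy | hyv
    · exact h (eq_of_between ht hS hu hy (yl.length_le.trans hl) huv h₁ hvy hv)
    · exact h (eq_of_between ht hS hx hv (vl.length_le.trans hl) hxy h₂ hyv hy).symm
  rcases List.suffix_or_suffix_of_suffix ul vl with a | a <;>
  rcases List.suffix_or_suffix_of_suffix xl yl with c | c
  · exact key hu hv hx hy a h₁ c h₂ vl yl h₆
  · exact key hu hv hy hx a h₁ c h₂.symm vl xl h₅
  · exact key hv hu hx hy a h₁.symm c h₂ ul yl h₄
  · exact key hv hu hy hx a h₁.symm c h₂.symm ul xl h₃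

/-- At most three vertices of a mutual-visibility set have words ending a given word. -/
theorem not_four (ht : 0 < t) (hS : IsMutualVisibilitySet (gluedTree r t) S) {l : List (Fin t)}
    (hl : l.length ≤ r) {p q x y : GluedTreeVertex r t} (hp : p ∈ S) (hq : q ∈ S) (hx : x ∈ S)
    (hy : y ∈ S) (pl : word p <:+ l) (ql : word q <:+ l) (xl : word x <:+ l) (yl : word y <:+ l)
    (hpq : p ≠ q) (hpx : p ≠ x) (hpy : p ≠ y) (hqx : q ≠ x) (hqy : q ≠ y) (hxy : x ≠ y) :
    False := by
  obtain ⟨bp, ep⟩ := exists_eq_node p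
  obtain ⟨bq, eq⟩ := exists_eq_node q
  obtain ⟨bx, ex⟩ := exists_eq_node x
  obtain ⟨b_y, ey⟩ := exists_eq_node y
  generalize word p = p', word q = q', word x = x', word y = y' at *
  subst ep eq ex ey
  have ne : ∀ {b : Bool} {u v : List (Fin t)}, node r b u ≠ node r b v → u ≠ v :=
    fun h e => h (e ▸ rfl)
  -- Of four vertices, three share a copy or each copy has two.
  cases bp <;> cases bq <;> cases bx <;> cases b_y
  all_goals first
    | exact not_three_on_side ht hS hl hp hq hx pl ql xl (ne hpq) (ne hpx) (ne hqx)
    | exact not_three_on_side ht hS hl hp hq hy pl ql yl (ne hpq) (ne hpy) (ne hqy)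
    | exact not_three_on_side ht hS hl hp hx hy pl xl yl (ne hpx) (ne hpy) (ne hxy)
    | exact not_three_on_side ht hS hl hq hx hy ql xl yl (ne hqx) (ne hqy) (ne hxy)
    | exact not_two_and_two ht hS hl hp hq hx hy pl ql xl yl (ne hpq) (ne hxy) hpx hpy hqx hqy
    | exact not_two_and_two ht hS hl hp hx hq hy pl xl ql yl (ne hpx) (ne hqy) hpq hpy hqx.symm hxy
    | exact not_two_and_two ht hS hl hp hy hq hx pl yl ql xl (ne hpy) (ne hqx) hpq hpx hqy.symm
        hxy.symm

theorem suffix_antisymm {α : Type*} {u v : List α} (h₁ : u <:+ v) (h₂ : v <:+ u) : u = v :=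
  h₁.eq_of_length_le h₂.length_le

theorem exists_eq_node_or (b : Bool) (v : GluedTreeVertex r t) :
    v = node r b (word v) ∨ v = node r (!b) (word v) ∧ (word v).length < r := by
  obtain ⟨c, hc⟩ := exists_eq_node v
  by_cases h : c = b
  · exact Or.inl (h ▸ hc)
  · obtain rfl : c = !b := by cases c <;> cases b <;> first | rfl | exact absurd rfl h
    rcases (length_word_le v).lt_or_eq with h' | h'
    · exact Or.inr ⟨hc, h'⟩
    · exact Or.inl (hc.trans (node_eq_node_of_length_eq _ _ h'))

theorem node_ne_node_of_length_lt {b : Bool} {u v : List (Fin t)} (hu : u.length ≤ r)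
    (hv : v.length < r) : node r b u ≠ node r (!b) v := fun h => by
  rcases (eq_of_node_eq_node hu hv.le h).2 with h | h
  · cases b <;> cases h
  · exact hv.ne h

-- Comparable pairs: triples and stars.

/-- Two vertices of the copy `b`, one below the other, and a vertex of the other copy, all on a
path through the tree of words. -/
structure IsTriple (S : Set (GluedTreeVertex r t)) (b : Bool) (x x' y : List (Fin t)) : Prop where
  left : node r b x ∈ S
  lower : node r b x' ∈ S
  right : node r (!b) y ∈ S
  suffix : x <:+ x'
  ne : x ≠ x'
  length_le : x'.length ≤ r
  suffix' : y <:+ x'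
  ne' : node r b x' ≠ node r (!b) y

/-- Otherwise the path from `u` to `x'`, which stays in copy `b`, would run through `x`. -/
theorem upper_suffix (ht : 0 < t) (hS : IsMutualVisibilitySet (gluedTree r t) S) {b : Bool}
    {x x' u : List (Fin t)} (hx : node r b x ∈ S) (hx' : node r b x' ∈ S) (hu : node r b u ∈ S)
    (h : x <:+ x') (hne : x ≠ x') (hr' : x'.length ≤ r) (hur : u.length < r) : x <:+ u := by
  by_contra hn
  have hxr : x.length ≤ r := h.length_le.trans hr'
  rcases same_side ht hS hu hx' hur hr' (between_of_not_suffix h hn) hx with e | e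
  · exact hn ((eq_of_node_eq_node hxr hur.le e).1 ▸ List.suffix_rfl)
  · exact hne (eq_of_node_eq_node hxr hr' e).1

theorem length_lt_of_suffix_ne {α : Type*} {u v : List α} (h : u <:+ v) (hne : u ≠ v) :
    u.length < v.length :=
  h.length_le.lt_of_ne fun e => hne (h.eq_of_length e)

/-- Without triples, a comparable pair `x`, `x'` in one copy forces `x` into every comparable pair.
-/
theorem star_of_same_side (ht : 0 < t) (hS : IsMutualVisibilitySet (gluedTree r t) S)
    (hno : ∀ b x x' y, ¬ IsTriple S b x x' y) {b : Bool} {x x' : List (Fin t)}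
    (hx : node r b x ∈ S) (hx' : node r b x' ∈ S) (h : x <:+ x') (hne : x ≠ x')
    (hr' : x'.length ≤ r) {p q : GluedTreeVertex r t} (hp : p ∈ S) (hq : q ∈ S) (hpq : p ≠ q)
    (hw : word p <:+ word q) : p = node r b x ∨ q = node r b x := by
  have hxx := length_lt_of_suffix_ne h hne
  have hp' := length_word_le p
  have hq' := length_word_le q
  -- If `u` differs from `x` then it lies below `x`. A `v` below `u` would be hidden from `x` by
  -- `u`, and a `v` above `u` would complete a triple.
  have cross : ∀ {u v : List (Fin t)}, node r b u ∈ S → node r (!b) v ∈ S → u.length < r →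
      v.length < r → u <:+ v ∨ v <:+ u → u = x := by
    intro u v hu hv hur hvr huv
    by_contra hux
    have hxu := upper_suffix ht hS hx hx' hu h hne hr' hur
    rcases huv with huv | huv
    · exact node_ne_node_of_length_lt hur.le hvr
        (eq_of_between ht hS hx hv hvr.le hxu (Ne.symm hux) huv hu)
    · exact hno b x u v ⟨hx, hu, hv, hxu, Ne.symm hux, hur.le, huv,
        node_ne_node_of_length_lt hur.le hvr⟩
  -- If `x` and `y` are comparable, one of the two pairs extends to a triple. If not, the path from
  -- `x'` to `y'` meets `x` or `y`, whichever copy it turns in.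
  have other : ∀ {y y' : List (Fin t)}, node r (!b) y ∈ S → node r (!b) y' ∈ S → y <:+ y' →
      y ≠ y' → y'.length ≤ r → False := by
    intro y y' hy hy' hyy hyne hyr
    have hyl := length_lt_of_suffix_ne hyy hyne
    have hyx : ¬ y <:+ x := fun hyx => hno b x x' y ⟨hx, hx', hy, h, hne, hr', hyx.trans h,
      node_ne_node_of_length_lt hr' (hyl.trans_le hyr)⟩
    have hxy : ¬ x <:+ y := fun hxy => hno (!b) y y' x ⟨hy, hy', by simpa using hx, hyy, hyne, hyr,
      hxy.trans hyy, node_ne_node_of_length_lt hyr (hxx.trans_le hr')⟩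
    have n₁ : ¬ x <:+ y' := fun k => (List.suffix_or_suffix_of_suffix hyy k).elim hyx hxy
    have n₂ : ¬ y <:+ x' := fun k => (List.suffix_or_suffix_of_suffix k h).elim hyx hxy
    rcases opposite_sides ht hS hx' hy' hr' hyr with ⟨-, k⟩ | ⟨-, k⟩
    · rcases k x (between_of_not_suffix h n₁).symm hx with e | e
      · exact hne (eq_of_node_eq_node (hxx.le.trans hr') hr' e).1
      · exact n₁ ((eq_of_node_eq_node (hxx.le.trans hr') hyr e).1 ▸ List.suffix_rfl)
    · rcases k y (between_of_not_suffix hyy n₂) hy with e | e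
      · exact n₂ ((eq_of_node_eq_node (hyl.le.trans hyr) hr' e).1 ▸ List.suffix_rfl)
      · exact hyne (eq_of_node_eq_node (hyl.le.trans hyr) hyr e).1
  have ne : ∀ c, p = node r c (word p) → q = node r c (word q) → word p ≠ word q :=
    fun c h₁ h₂ e => hpq (h₁.trans (e ▸ h₂.symm))
  rcases exists_eq_node_or b p with ep | ⟨ep, lp⟩ <;>
  rcases exists_eq_node_or b q with eq | ⟨eq, lq⟩
  · left
    have hl := length_lt_of_suffix_ne hw (ne b ep eq)
    rw [ep] at hp ⊢
    rw [eq] at hq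
    rw [suffix_antisymm (upper_suffix ht hS hx hx' hp h hne hr' (hl.trans_le hq'))
      (upper_suffix ht hS hp hq hx hw (ne b ep eq) hq' (hxx.trans_le hr'))]
  · left
    have hl := hw.length_le.trans_lt lq
    rw [ep] at hp ⊢
    rw [eq] at hq
    rw [cross hp hq hl lq (Or.inl hw)]
  · rcases hq'.lt_or_eq with lq | lq
    · right
      rw [ep] at hp
      rw [eq] at hq ⊢
      rw [cross hq hp lq lp (Or.inr hw)]
    · have eq' : q = node r (!b) (word q) := eq.trans (node_eq_node_of_length_eq _ _ lq)
      have n := ne _ ep eq'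
      rw [ep] at hp
      rw [eq'] at hq
      exact (other hp hq hw n hq').elim
  · have n := ne _ ep eq
    rw [ep] at hp
    rw [eq] at hq
    exact (other hp hq hw n hq').elim

/-- Visibility of `u` and `y'`, and of `u'` and `y`, each yields a chain of depth inequalities; in
all four combinations these contradict each other. -/
theorem no_disjoint_pairs (ht : 0 < t) (hS : IsMutualVisibilitySet (gluedTree r t) S) {b : Bool}
    (hno : ∀ b u v, node r b u ∈ S → node r b v ∈ S → u <:+ v → v.length ≤ r → u = v)
    {u y u' y' : List (Fin t)} (hu : node r b u ∈ S) (hy : node r (!b) y ∈ S)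
    (hu' : node r b u' ∈ S) (hy' : node r (!b) y' ∈ S) (lu : u.length < r) (ly : y.length < r)
    (lu' : u'.length < r) (ly' : y'.length < r) (h : u <:+ y ∨ y <:+ u)
    (h' : u' <:+ y' ∨ y' <:+ u') (hne : u ≠ u') (hne' : y ≠ y') : False := by
  have i₁ : ¬ u <:+ u' := fun k => hne (hno b _ _ hu hu' k lu'.le)
  have i₂ : ¬ u' <:+ u := fun k => hne (hno b _ _ hu' hu k lu.le).symm
  have i₃ : ¬ y <:+ y' := fun k => hne' (hno _ _ _ hy hy' k ly'.le)
  have i₄ : ¬ y' <:+ y := fun k => hne' (hno _ _ _ hy' hy k ly.le).symm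
  have side : ∀ {u y u' y' : List (Fin t)}, node r b u ∈ S → node r (!b) y ∈ S →
      node r b u' ∈ S → node r (!b) y' ∈ S → u.length < r → y.length < r →
      u'.length < r → y'.length < r → u <:+ y ∨ y <:+ u → u' <:+ y' ∨ y' <:+ u' →
      ¬ u <:+ u' → ¬ u' <:+ u → ¬ y <:+ y' → ¬ y' <:+ y →
      (u.length ≤ y'.length ∧ y'.length < u'.length) ∨
        (y'.length ≤ u.length ∧ u.length < y.length) := by
    intro u y u' y' hu hy hu' hy' lu ly lu' ly' h h' i₁ i₂ i₃ i₄
    rcases opposite_sides ht hS hu hy' lu.le ly'.le with ⟨k₁, k₂⟩ | ⟨k₁, k₂⟩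
    · refine Or.inl ⟨k₁, ?_⟩
      rcases h' with h' | h'
      · exfalso
        rcases k₂ u' (between_of_not_suffix h' i₂) hu' with e | e
        · exact i₂ ((eq_of_node_eq_node lu'.le lu.le e).1 ▸ List.suffix_rfl)
        · exact node_ne_node_of_length_lt lu'.le ly' e
      · refine length_lt_of_suffix_ne h' ?_
        rintro rfl
        rcases k₂ y' (between_of_not_suffix List.suffix_rfl i₂) hu' with e | e
        · exact i₂ ((eq_of_node_eq_node lu'.le lu.le e).1 ▸ List.suffix_rfl)
        · exact node_ne_node_of_length_lt lu'.le ly' e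
    · refine Or.inr ⟨k₁, ?_⟩
      have no : ¬ y <:+ u := by
        intro h
        rcases k₂ y (between_of_not_suffix h i₃).symm hy with e | e
        · exact node_ne_node_of_length_lt lu.le ly e.symm
        · exact i₃ ((eq_of_node_eq_node ly.le ly'.le e).1 ▸ List.suffix_rfl)
      have h := h.resolve_right no
      exact length_lt_of_suffix_ne h fun e => no (e ▸ List.suffix_rfl)
  have := side hu hy hu' hy' lu ly lu' ly' h h' i₁ i₂ i₃ i₄
  have := side hu' hy' hu hy lu' ly' lu ly h' h i₂ i₁ i₄ i₃
  omega

/-- In the absence of triples, some vertex meets all pairs with comparable words. -/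
theorem exists_star (ht : 0 < t) (hS : IsMutualVisibilitySet (gluedTree r t) S)
    (hno : ∀ b x x' y, ¬ IsTriple S b x x' y) :
    ∃ v, ∀ p ∈ S, ∀ q ∈ S, p ≠ q → word p <:+ word q → p = v ∨ q = v := by
  by_cases hside : ∀ b u v, node r b u ∈ S → node r b v ∈ S → u <:+ v → v.length ≤ r → u = v
  swap
  · push Not at hside
    obtain ⟨b, x, x', hx, hx', h, hr', hne⟩ := hside
    exact ⟨_, fun p hp q hq hpq hw => star_of_same_side ht hS hno hx hx' h hne hr' hp hq hpq hw⟩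
  -- Now each copy contributes an antichain, so comparable pairs are edges of a bipartite graph,
  -- pairwise intersecting by `no_disjoint_pairs`. Having no triangle, such a graph is a star.
  have cross : ∀ p ∈ S, ∀ q ∈ S, p ≠ q → word p <:+ word q → ∃ u v, node r true u ∈ S ∧
      node r false v ∈ S ∧ u.length < r ∧ v.length < r ∧ (u <:+ v ∨ v <:+ u) ∧
      ((p = node r true u ∧ q = node r false v) ∨ (q = node r true u ∧ p = node r false v)) := by
    intro p hp q hq hpq hw
    have ne : ∀ c, p = node r c (word p) → q = node r c (word q) → False := by
      intro c h₁ h₂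
      refine hpq (h₁.trans (Eq.trans ?_ h₂.symm))
      rw [hside c _ _ (h₁ ▸ hp) (h₂ ▸ hq) hw (length_word_le q)]
    rcases exists_eq_node_or true p with ep | ⟨ep, lp⟩ <;>
    rcases exists_eq_node_or true q with eq | ⟨eq, lq⟩
    · exact (ne _ ep eq).elim
    · exact ⟨word p, word q, ep ▸ hp, eq ▸ hq, hw.length_le.trans_lt lq, lq, Or.inl hw,
        Or.inl ⟨ep, eq⟩⟩
    · rcases (length_word_le q).lt_or_eq with lq | lq
      · exact ⟨word q, word p, eq ▸ hq, ep ▸ hp, lq, lp, Or.inr hw, Or.inr ⟨eq, ep⟩⟩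
      · exact (ne _ ep (eq.trans (node_eq_node_of_length_eq _ _ lq))).elim
    · exact (ne _ ep eq).elim
  by_contra hcon
  push Not at hcon
  obtain ⟨p, hp, q, hq, hpq, hw, -, -⟩ := hcon (node r true [])
  obtain ⟨u, v, hu, hv, lu, lv, huv, -⟩ := cross p hp q hq hpq hw
  obtain ⟨p₁, hp₁, q₁, hq₁, hpq₁, hw₁, n₁, n₁'⟩ := hcon (node r true u)
  obtain ⟨p₂, hp₂, q₂, hq₂, hpq₂, hw₂, n₂, n₂'⟩ := hcon (node r false v)
  obtain ⟨u₁, v₁, hu₁, hv₁, lu₁, lv₁, huv₁, e₁⟩ := cross p₁ hp₁ q₁ hq₁ hpq₁ hw₁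
  obtain ⟨u₂, v₂, hu₂, hv₂, lu₂, lv₂, huv₂, e₂⟩ := cross p₂ hp₂ q₂ hq₂ hpq₂ hw₂
  have k₁ : u₁ ≠ u := by
    rintro rfl
    rcases e₁ with e | e
    exacts [n₁ e.1, n₁' e.1]
  have k₂ : v₂ ≠ v := by
    rintro rfl
    rcases e₂ with e | e
    exacts [n₂' e.2, n₂ e.2]
  have dis : ∀ {u v u' v' : List (Fin t)}, node r true u ∈ S → node r false v ∈ S →
      node r true u' ∈ S → node r false v' ∈ S → u.length < r → v.length < r → u'.length < r →
      v'.length < r → u <:+ v ∨ v <:+ u → u' <:+ v' ∨ v' <:+ u' → u ≠ u' → v = v' := by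
    intro u v u' v' a₁ a₂ a₃ a₄ a₅ a₆ a₇ a₈ a₉ b₁ b₂
    by_contra b₃
    exact no_disjoint_pairs ht hS (b := true) hside a₁ a₂ a₃ a₄ a₅ a₆ a₇ a₈ a₉ b₁ b₂ b₃
  have e₁ := dis hu₁ hv₁ hu hv lu₁ lv₁ lu lv huv₁ huv k₁
  by_cases e : u₂ = u
  · subst e
    exact k₂ (e₁ ▸ (dis hu₂ hv₂ hu₁ hv₁ lu₂ lv₂ lu₁ lv₁ huv₂ huv₁ k₁.symm))
  · exact k₂ (dis hu₂ hv₂ hu hv lu₂ lv₂ lu lv huv₂ huv e)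

/-- In the presence of a triple, all further vertices lie below a child of the vertex of the triple
with the shortest word. -/
theorem IsTriple.exists_child (ht : 0 < t) (hS : IsMutualVisibilitySet (gluedTree r t) S)
    {b : Bool} {x x' y m : List (Fin t)} (h : IsTriple S b x x' y) (hmx : m <:+ x) (hmy : m <:+ y)
    (hm : m = x ∨ m = y) : ∃ j, (j :: m) <:+ x' ∧
      ∀ z ∈ S, z ≠ node r b x → z ≠ node r (!b) y → (j :: m) <:+ word z := by
  have hxx := length_lt_of_suffix_ne h.suffix h.ne
  have hxr := hxx.le.trans h.length_le
  have hyr := h.suffix'.length_le.trans h.length_le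
  have hlt : m.length < x'.length := hmx.length_le.trans_lt hxx
  obtain ⟨j, hj⟩ := exists_cons_suffix (hmx.trans h.suffix) fun e => hlt.ne (congrArg _ e)
  refine ⟨j, hj, fun z hz n₁ n₂ => ?_⟩
  by_contra hn
  have common : ∀ a, a <:+ word z → a <:+ x' → a <:+ m := by
    intro a h₁ h₂
    rcases List.suffix_or_suffix_of_suffix h₂ hj with k | k
    · rcases List.suffix_cons_iff.1 k with rfl | k
      · exact absurd h₁ hn
      · exact k
    · exact absurd (k.trans h₁) hn
  have wx' : word (node r b x') = x' := word_node h.length_le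
  have nz : z ≠ node r b x' := by
    rintro rfl
    rw [wx'] at hn
    exact hn hj
  have nx : node r b x ≠ node r b x' := fun e => h.ne (eq_of_node_eq_node hxr h.length_le e).1
  -- A `z` on the branch of `x'` would be a fourth vertex there. Otherwise the path from `z` to `x'`
  -- enters that branch at or above `m`, so it meets `x` or `y` according to the copy in which it
  -- turns.
  by_cases hzx : word z <:+ x'
  · have nxy : node r b x ≠ node r (!b) y := fun e => by
      rcases (eq_of_node_eq_node hxr hyr e).2 with e' | e'
      · cases b <;> cases e'
      · have := (eq_of_node_eq_node hxr hyr e).1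
        have := h.length_le
        subst x
        omega
    exact not_four ht hS h.length_le hz h.left h.lower h.right hzx
      (by rw [word_node hxr]; exact h.suffix) (by rw [wx'])
      (by rw [word_node hyr]; exact h.suffix') n₁ nz n₂ nx nxy h.ne'
  · obtain ⟨e, -, he⟩ := exists_side ht hS hz h.lower
    rw [wx'] at he
    by_cases eb : e = b
    · subst eb
      rcases he x ⟨Or.inr h.suffix, fun a h₁ h₂ => (common a h₁ h₂).trans hmx⟩ h.left with k | k
      · exact n₁ k.symm
      · exact nx k
    · obtain rfl : e = !b := by cases e <;> cases b <;> first | rfl | exact absurd rfl eb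
      rcases he y ⟨Or.inr h.suffix', fun a h₁ h₂ => (common a h₁ h₂).trans hmy⟩ h.right with k | k
      · exact n₂ k.symm
      · exact h.ne' k.symm

-- Weights and the lower bound.

theorem card_leaves_below {w : List (Fin t)} (hw : w.length ≤ r) :
    (Finset.univ.filter fun l : List.Vector (Fin t) r => w <:+ l.1).card =
      t ^ (r - w.length) := by
  have e : t ^ (r - w.length) = (Finset.univ : Finset (List.Vector (Fin t) (r - w.length))).card := by
    rw [Finset.card_univ, card_vector, Fintype.card_fin]
  rw [e]
  symm
  refine Finset.card_bij (fun l _ => ⟨l.1 ++ w, by rw [List.length_append, l.2]; omega⟩) ?_ ?_ ?_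
  · exact fun l _ => Finset.mem_filter.2 ⟨Finset.mem_univ _, List.suffix_append _ _⟩
  · intro a _ b _ h
    exact Subtype.ext (List.append_cancel_right (congrArg Subtype.val h))
  · rintro ⟨l, hl⟩ h
    obtain ⟨a, rfl⟩ := (Finset.mem_filter.1 h).2
    exact ⟨⟨a, by rw [List.length_append] at hl; omega⟩, Finset.mem_univ _, rfl⟩

/-- A weighted count of vertices, by the numbers of leaves below them. -/
theorem sum_leaves_below_le (A : Finset (GluedTreeVertex r t)) (m : ℕ) {c : List (Fin t)}
    (hcr : c.length ≤ r) (hc : ∀ v ∈ A, c <:+ word v)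
    (hm : ∀ l : List (Fin t), l.length = r → (A.filter fun v => word v <:+ l).card ≤ m) :
    ∑ v ∈ A, t ^ (r - (word v).length) ≤ m * t ^ (r - c.length) := by
  -- Double counting of pairs of a vertex and a leaf word below it.
  have h₁ : ∑ v ∈ A, t ^ (r - (word v).length) =
      ∑ l : List.Vector (Fin t) r, (A.filter fun v => word v <:+ l.1).card := by
    simp_rw [← card_leaves_below (length_word_le _), Finset.card_filter]
    exact Finset.sum_comm
  rw [h₁, ← card_leaves_below hcr, mul_comm, ← smul_eq_mul, ← Finset.sum_const, Finset.sum_filter]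
  refine Finset.sum_le_sum fun l _ => ?_
  split_ifs with h
  · exact hm _ l.2
  · refine (Finset.card_eq_zero.2 (Finset.filter_eq_empty_iff.2 fun v hv k => h ?_)).le
    exact (hc v hv).trans k

/-- The weight of a vertex: vertices of depth at most `k` have weight `t ^ (r - k)`, deeper ones
are weighted by the number of leaves below them. -/
def weight (k : ℕ) (v : GluedTreeVertex r t) : ℕ := t ^ (r - max (word v).length k)

theorem weight_le (ht : 0 < t) (k : ℕ) (v : GluedTreeVertex r t) : weight k v ≤ t ^ (r - k) :=
  Nat.pow_le_pow_right ht (by omega)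

theorem weight_le' (ht : 0 < t) (k : ℕ) (v : GluedTreeVertex r t) :
    weight k v ≤ t ^ (r - (word v).length) :=
  Nat.pow_le_pow_right ht (by omega)

theorem sum_weight_le_erase [DecidableEq (GluedTreeVertex r t)] (ht : 0 < t) (k : ℕ)
    (A : Finset (GluedTreeVertex r t)) (v : GluedTreeVertex r t) :
    ∑ x ∈ A, weight k x ≤ t ^ (r - k) + ∑ x ∈ A.erase v, weight k x := by
  have h : A ⊆ insert v (A.erase v) := fun x hx => by
    rw [Finset.mem_insert, Finset.mem_erase]
    exact (em (x = v)).imp id fun h => ⟨h, hx⟩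
  refine (Finset.sum_le_sum_of_subset h).trans ?_
  rw [Finset.sum_insert (Finset.notMem_erase v A)]
  exact Nat.add_le_add_right (weight_le ht k v) _

theorem sum_weight_le_of_multiplicity (ht : 0 < t) (k : ℕ) (A : Finset (GluedTreeVertex r t))
    (m : ℕ) {c : List (Fin t)} (hcr : c.length ≤ r) (hc : ∀ v ∈ A, c <:+ word v)
    (hm : ∀ l : List (Fin t), l.length = r → (A.filter fun v => word v <:+ l).card ≤ m) :
    ∑ v ∈ A, weight k v ≤ m * t ^ (r - c.length) :=
  (Finset.sum_le_sum fun v _ => weight_le' ht k v).trans (sum_leaves_below_le A m hcr hc hm)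

/-- Every branch through the child also contains `p`, so by `not_four` it holds at most two other
vertices. The factor 2 is paid for by the child carrying at most 1/t of the leaves. -/
theorem sum_weight_le_of_erase_one [DecidableEq (GluedTreeVertex r t)] (ht : 2 ≤ t) (k : ℕ)
    {A : Finset (GluedTreeVertex r t)} (hA : IsMutualVisibilitySet (gluedTree r t) (A : Set _))
    {p : GluedTreeVertex r t} (hp : p ∈ A) {j : Fin t} {m : List (Fin t)}
    (hm : (j :: m).length ≤ r) (hpm : word p = m)
    (hc : ∀ v ∈ A, v ≠ p → (j :: m) <:+ word v) :
    ∑ v ∈ A, weight k v ≤ t ^ r + t ^ (r - k) := by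
  have ht' : 0 < t := by omega
  refine (sum_weight_le_erase ht' k A p).trans ?_
  have hc' : ∀ v ∈ A.erase p, (j :: m) <:+ word v := fun v hv =>
    hc v (Finset.mem_of_mem_erase hv) (Finset.ne_of_mem_erase hv)
  have h := sum_weight_le_of_multiplicity ht' k (A.erase p) 2 hm hc' fun l hl => by
    by_contra hcon
    obtain ⟨x, y, z, hx, hy, hz, hxy, hxz, hyz⟩ := Finset.two_lt_card_iff.1 (not_le.1 hcon)
    rw [Finset.mem_filter, Finset.mem_erase] at hx hy hz
    have hpl : word p <:+ l := hpm ▸ ((List.suffix_cons j m).trans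
      (hc x hx.1.2 hx.1.1)).trans hx.2
    exact not_four ht' hA hl.le hp hx.1.2 hy.1.2 hz.1.2 hpl hx.2 hy.2 hz.2 hx.1.1.symm hy.1.1.symm
      hz.1.1.symm hxy hxz hyz
  have h₂ : 2 * t ^ (r - (j :: m).length) ≤ t ^ r := by
    obtain ⟨n, rfl⟩ : ∃ n, r = n + 1 := ⟨r - 1, by rw [List.length_cons] at hm; omega⟩
    calc 2 * t ^ (n + 1 - (j :: m).length) ≤ t * t ^ n :=
          Nat.mul_le_mul ht (Nat.pow_le_pow_right ht' (by rw [List.length_cons]; omega))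
      _ = t ^ (n + 1) := by ring
  omega

theorem sum_weight_le_of_isTriple (ht : 2 ≤ t) {k : ℕ} (hk : 1 ≤ k)
    {A : Finset (GluedTreeVertex r t)} (hA : IsMutualVisibilitySet (gluedTree r t) (A : Set _))
    {b : Bool} {x x' y : List (Fin t)} (h : IsTriple (A : Set (GluedTreeVertex r t)) b x x' y) :
    ∑ v ∈ A, weight k v ≤ t ^ r + t ^ (r - k) := by
  classical
  have ht' : 0 < t := by omega
  have hxr : x.length ≤ r := h.suffix.length_le.trans h.length_le
  have hyr : y.length ≤ r := h.suffix'.length_le.trans h.length_le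
  by_cases hxy : x = y
  · subst hxy
    obtain ⟨j, hj, hc⟩ := h.exists_child ht' hA List.suffix_rfl List.suffix_rfl (Or.inl rfl)
    have hjr := hj.length_le.trans h.length_le
    refine (sum_weight_le_erase ht' k A (node r b x)).trans ?_
    refine (Nat.add_le_add_left (sum_weight_le_erase ht' k _ (node r (!b) x)) _).trans ?_
    have nxy : node r b x ≠ node r (!b) x :=
      node_ne_node_of_length_lt hxr (by rw [List.length_cons] at hjr; omega)
    have hc' : ∀ v ∈ (A.erase (node r b x)).erase (node r (!b) x), (j :: x) <:+ word v := by
      intro v hv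
      rw [Finset.mem_erase, Finset.mem_erase] at hv
      exact hc v hv.2.2 hv.2.1 hv.1
    have := sum_weight_le_of_multiplicity ht' k _ 1 hjr hc' fun l hl => by
      by_contra hcon
      obtain ⟨u, hu, v, hv, huv⟩ := Finset.one_lt_card.1 (not_le.1 hcon)
      have hxl := ((List.suffix_cons j x).trans (hc' u (Finset.mem_filter.1 hu).1)).trans
        (Finset.mem_filter.1 hu).2
      rw [Finset.mem_filter, Finset.mem_erase, Finset.mem_erase] at hu hv
      exact not_four ht' hA hl.le h.left h.right hu.1.2.2 hv.1.2.2 (by rwa [word_node hxr])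
        (by rwa [word_node hxr]) hu.2 hv.2 nxy hu.1.2.1.symm hv.1.2.1.symm hu.1.1.symm
        hv.1.1.symm huv
    obtain ⟨n, rfl⟩ : ∃ n, r = n + 1 := ⟨r - 1, by rw [List.length_cons] at hjr; omega⟩
    have h₁ : t ^ (n + 1 - (j :: x).length) ≤ t ^ n :=
      Nat.pow_le_pow_right ht' (by rw [List.length_cons]; omega)
    -- Two vertices were removed; since `k ≥ 1`, the second one and the rest weigh at most `t ^ n`
    -- each, together at most `t ^ (n + 1)`.
    have h₂ : t ^ (n + 1 - k) ≤ t ^ n := Nat.pow_le_pow_right ht' (by omega)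
    have h₃ : 2 * t ^ n ≤ t ^ (n + 1) := by rw [pow_succ, mul_comm]; exact Nat.mul_le_mul_left _ ht
    omega
  · rcases List.suffix_or_suffix_of_suffix h.suffix h.suffix' with k₁ | k₁
    · obtain ⟨j, hj, hc⟩ := h.exists_child ht' hA List.suffix_rfl k₁ (Or.inl rfl)
      have hjr := hj.length_le.trans h.length_le
      refine sum_weight_le_of_erase_one ht k hA h.left hjr (word_node hxr) fun v hv n => ?_
      by_cases e : v = node r (!b) y
      · rw [e, word_node hyr]
        -- As `y` lies on the branch to `x'` strictly below `x`, it is below the same child.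
        obtain ⟨j', hj'⟩ := exists_cons_suffix k₁ hxy
        have := List.suffix_of_suffix_length_le hj (hj'.trans h.suffix') (by simp)
        exact this.trans hj'
      · exact hc v hv n e
    · obtain ⟨j, hj, hc⟩ := h.exists_child ht' hA k₁ List.suffix_rfl (Or.inr rfl)
      have hjr := hj.length_le.trans h.length_le
      refine sum_weight_le_of_erase_one ht k hA h.right hjr (word_node hyr) fun v hv n => ?_
      by_cases e : v = node r b x
      · rw [e, word_node hxr]
        obtain ⟨j', hj'⟩ := exists_cons_suffix k₁ (Ne.symm hxy)
        have := List.suffix_of_suffix_length_le hj (hj'.trans h.suffix) (by simp)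
        exact this.trans hj'
      · exact hc v hv e n

theorem sum_weight_le (ht : 2 ≤ t) {k : ℕ} (hk : 1 ≤ k) {A : Finset (GluedTreeVertex r t)}
    (hA : IsMutualVisibilitySet (gluedTree r t) (A : Set _)) :
    ∑ v ∈ A, weight k v ≤ t ^ r + t ^ (r - k) := by
  classical
  have ht' : 0 < t := by omega
  by_cases hno : ∀ b x x' y, ¬ IsTriple (A : Set (GluedTreeVertex r t)) b x x' y
  · obtain ⟨v, hv⟩ := exists_star ht' hA hno
    refine (sum_weight_le_erase ht' k A v).trans ?_
    -- Removing the centre of the star leaves an antichain of words.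
    have := sum_weight_le_of_multiplicity ht' k (A.erase v) 1 (c := []) (Nat.zero_le _)
      (fun _ _ => List.nil_suffix) fun l hl => by
        by_contra hcon
        obtain ⟨p, hp, q, hq, hpq⟩ := Finset.one_lt_card.1 (not_le.1 hcon)
        rw [Finset.mem_filter, Finset.mem_erase] at hp hq
        rcases List.suffix_or_suffix_of_suffix hp.2 hq.2 with h | h
        · exact (hv p hp.1.2 q hq.1.2 hpq h).elim hp.1.1 hq.1.1
        · exact (hv q hq.1.2 p hp.1.2 hpq.symm h).elim hq.1.1 hp.1.1
    rw [one_mul, List.length_nil, Nat.sub_zero] at this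
    omega
  · push Not at hno
    obtain ⟨b, x, x', y, h⟩ := hno
    exact sum_weight_le_of_isTriple ht hk hA h

theorem sum_range_pow_mul {k : ℕ} (hk : k ≤ r) :
    ∑ d ∈ Finset.range r, t ^ d * t ^ (r - max d k) =
      (∑ d ∈ Finset.range k, t ^ d) * t ^ (r - k) + (r - k) * t ^ r := by
  obtain ⟨n, rfl⟩ := Nat.exists_eq_add_of_le hk
  rw [Finset.sum_range_add, Finset.sum_mul]
  congr 1
  · refine Finset.sum_congr rfl fun d hd => ?_
    rw [max_eq_right (Finset.mem_range.1 hd).le]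
  · rw [Finset.sum_congr rfl (g := fun _ => t ^ (k + n))]
    · simp
    · intro d hd
      have := Finset.mem_range.1 hd
      rw [max_eq_left (Nat.le_add_right k d), ← pow_add]
      congr 1
      omega

/-- The left side sums the weights over the non-leaf levels of both copies and over the leaves once.
Injectivity of this enumeration suffices for the bound. -/
theorem le_sum_weight [Fintype (GluedTreeVertex r t)] {k : ℕ} (hk : k ≤ r) :
    2 * ((∑ d ∈ Finset.range k, t ^ d) * t ^ (r - k) + (r - k) * t ^ r) + t ^ r ≤
      ∑ v : GluedTreeVertex r t, weight k v := by
  classical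
  let f : (Σ i : Bool × Fin r, List.Vector (Fin t) i.2) ⊕ List.Vector (Fin t) r →
      GluedTreeVertex r t := Sum.elim (fun a => node r a.1.1 a.2.1) fun l => node r true l.1
  have lt : ∀ a : Σ i : Bool × Fin r, List.Vector (Fin t) i.2, a.2.1.length < r := fun a => by
    rw [a.2.2]; exact a.1.2.2
  have hf : Function.Injective f := by
    rintro (a | a) (b | b) h
    · have h₁ := (eq_of_node_eq_node (lt a).le (lt b).le h).1
      have h₂ := (eq_of_node_eq_node (lt a).le (lt b).le h).2.resolve_right (lt b).ne
      obtain ⟨⟨a₁, ⟨n, hn⟩⟩, a₂, ha⟩ := a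
      obtain ⟨⟨b₁, ⟨n', hn'⟩⟩, b₂, hb⟩ := b
      dsimp only at h₁ h₂
      subst h₁ h₂
      obtain rfl : n = n' := ha.symm.trans hb
      rfl
    · have := congrArg List.length (eq_of_node_eq_node (lt a).le b.2.le h).1
      exact absurd (this.trans b.2) (lt a).ne
    · have := congrArg List.length (eq_of_node_eq_node a.2.le (lt b).le h).1
      exact absurd (this.symm.trans a.2) (lt b).ne
    · exact congrArg _ (Subtype.ext (eq_of_node_eq_node a.2.le b.2.le h).1)
  have key : ∑ x, weight k (f x) ≤ ∑ v : GluedTreeVertex r t, weight k v := by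
    rw [← Finset.sum_image (f := weight k) (g := f) (s := Finset.univ) hf.injOn]
    exact Finset.sum_le_sum_of_subset (Finset.subset_univ _)
  refine le_trans (le_of_eq ?_) key
  rw [Fintype.sum_sum_type, Fintype.sum_sigma, Fintype.sum_prod_type, Fintype.sum_bool, two_mul]
  have e₁ : ∀ c : Bool, ∑ i : Fin r, ∑ a : List.Vector (Fin t) i, weight k (f (.inl ⟨(c, i), a⟩)) =
      (∑ d ∈ Finset.range k, t ^ d) * t ^ (r - k) + (r - k) * t ^ r := by
    intro c
    rw [← sum_range_pow_mul hk, ← Fin.sum_univ_eq_sum_range (fun d => t ^ d * t ^ (r - max d k))]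
    refine Finset.sum_congr rfl fun i _ => ?_
    rw [Finset.sum_congr rfl (g := fun _ => t ^ (r - max (i : ℕ) k))]
    · rw [Finset.sum_const, Finset.card_univ, card_vector, Fintype.card_fin, smul_eq_mul]
    · intro a _
      have hl : a.1.length ≤ r := by rw [a.2]; exact i.2.le
      change t ^ (r - max (word (node r c a.1)).length k) = _
      rw [word_node hl, a.2]
  have e₂ : ∑ a : List.Vector (Fin t) r, weight k (f (.inr a)) = t ^ r := by
    rw [Finset.sum_congr rfl (g := fun _ => 1)]
    · simp
    · intro a _
      change t ^ (r - max (word (node r true a.1)).length k) = _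
      rw [word_node a.2.le, a.2, max_eq_left hk, Nat.sub_self, pow_zero]
  rw [e₂]
  exact congrArg (· + t ^ r) (congrArg₂ (· + ·) (e₁ true).symm (e₁ false).symm)

/-- A lower bound for the number of colours. -/
theorem le_of_colorable (ht : 2 ≤ t) {k n : ℕ} (hk : 1 ≤ k) (hkr : k ≤ r)
    (h : MutualVisibilityColorable (gluedTree r t) n) :
    2 * (∑ d ∈ Finset.range k, t ^ d) + (2 * (r - k) + 1) * t ^ k ≤ n * (t ^ k + 1) := by
  classical
  obtain ⟨c, hc⟩ := h
  have := Fintype.ofFinite (GluedTreeVertex r t)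
  have h₁ := le_sum_weight (t := t) hkr
  rw [← Finset.sum_fiberwise _ c] at h₁
  have h₂ : ∑ a, ∑ v with c v = a, weight k v ≤ ∑ _a : Fin n, (t ^ r + t ^ (r - k)) :=
    Finset.sum_le_sum fun a _ => sum_weight_le ht hk (by simpa using hc a)
  rw [Finset.sum_const, Finset.card_univ, Fintype.card_fin, smul_eq_mul] at h₂
  have h₃ := h₁.trans h₂
  have e : t ^ r = t ^ k * t ^ (r - k) := by rw [← pow_add]; congr 1; omega
  rw [e] at h₃
  refine Nat.le_of_mul_le_mul_right (c := t ^ (r - k)) (le_of_eq_of_le ?_ (h₃.trans_eq ?_))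
    (by positivity)
  · ring
  · ring

-- Explicit shortest paths.

theorem le_length {x y : GluedTreeVertex r t} (p : (gluedTree r t).Walk x y) {d : List (Fin t)}
    (h₁ : d <:+ word x) (h₃ : ∀ a, a <:+ word x → a <:+ word y → a <:+ d) :
    ∃ e, lev e x + lev e y ≤ p.length + d.length + d.length := by
  obtain ⟨e, he⟩ := exists_node_mem_support p h₁ h₃
  obtain ⟨p₁, p₂, hl, -⟩ := exists_split_of_mem_support p he
  have k₁ := lev_le_of_walk e p₁
  have k₂ := lev_le_of_walk' e p₂
  rw [lev_node (h₁.length_le.trans (length_word_le x)), if_pos rfl] at k₁ k₂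
  exact ⟨e, by omega⟩

theorem length_eq_dist {V : Type*} {G : SimpleGraph V} {x y : V} (p : G.Walk x y)
    (h : ∀ q : G.Walk x y, p.length ≤ q.length) : p.length = G.dist x y := by
  obtain ⟨q, hq⟩ := p.reachable.exists_walk_length_eq_dist
  exact le_antisymm (hq ▸ h q) (dist_le p)

theorem exists_geodesic_same_side (e : Bool) {u v : List (Fin t)} (hu : u.length ≤ r)
    (hv : v.length ≤ r) : ∃ p : (gluedTree r t).Walk (node r e u) (node r e v),
      p.length = (gluedTree r t).dist (node r e u) (node r e v) ∧
      ∀ z ∈ p.support, ∃ s, z = node r e s ∧ s.length ≤ r ∧ (s <:+ u ∨ s <:+ v) := by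
  obtain ⟨d, h₁, h₂, h₃⟩ := exists_longest_common_suffix u v
  obtain ⟨p, hp, sp⟩ := exists_walk_down e h₁ hu
  obtain ⟨q, hq, sq⟩ := exists_walk_down e h₂ hv
  refine ⟨p.reverse.append q, length_eq_dist _ fun w => ?_, fun z hz => ?_⟩
  · obtain ⟨c, hc⟩ := le_length w (d := d) (by rwa [word_node hu])
      (by rwa [word_node hu, word_node hv])
    rw [lev_node hu, lev_node hv] at hc
    rw [Walk.length_append, Walk.length_reverse]
    split_ifs at hc <;> omega
  · rw [Walk.mem_support_append_iff, Walk.support_reverse, List.mem_reverse] at hz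
    rcases hz with hz | hz
    · obtain ⟨s, h, -, h'⟩ := sp z hz
      exact ⟨s, h, h'.length_le.trans hu, Or.inl h'⟩
    · obtain ⟨s, h, -, h'⟩ := sq z hz
      exact ⟨s, h, h'.length_le.trans hv, Or.inr h'⟩

/-- The path climbs from `u` to the common suffix, descends in copy `e` past the twin of `v` to a
leaf, and climbs to `v`. It is shortest because `u` is no deeper than `v`. -/
theorem exists_geodesic_opposite_sides (ht : 0 < t) (e : Bool) {u v : List (Fin t)}
    (huv : u.length ≤ v.length) (hv : v.length ≤ r) :
    ∃ p : (gluedTree r t).Walk (node r e u) (node r (!e) v),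
      p.length = (gluedTree r t).dist (node r e u) (node r (!e) v) ∧
      ∀ z ∈ p.support, (∃ s, z = node r e s ∧ s.length ≤ r ∧ (s <:+ u ∨ s <:+ v ∨ v <:+ s)) ∨
        ∃ s, z = node r (!e) s ∧ s.length ≤ r ∧ v <:+ s := by
  have hu := huv.trans hv
  obtain ⟨d, h₁, h₂, h₃⟩ := exists_longest_common_suffix u v
  obtain ⟨l, hvl, hl⟩ := exists_suffix_length_eq ht hv
  obtain ⟨p, hp, sp⟩ := exists_walk_down e h₁ hu
  obtain ⟨q, hq, sq⟩ := exists_walk_across e (h₂.trans hvl) hvl hl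
  refine ⟨p.reverse.append q, length_eq_dist _ fun w => ?_, fun z hz => ?_⟩
  · obtain ⟨c, hc⟩ := le_length w (d := d) (by rwa [word_node hu])
      (by rwa [word_node hu, word_node hv])
    rw [lev_node hu, lev_node hv] at hc
    rw [Walk.length_append, Walk.length_reverse]
    have := h₁.length_le
    have := h₂.length_le
    by_cases hce : c = e
    · subst hce
      rw [if_pos rfl, if_neg (by cases c <;> decide)] at hc
      omega
    · rw [if_neg hce, if_pos (by cases c <;> cases e <;> simp_all)] at hc
      omega
  · rw [Walk.mem_support_append_iff, Walk.support_reverse, List.mem_reverse] at hz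
    rcases hz with hz | hz
    · obtain ⟨s, h, -, h'⟩ := sp z hz
      exact Or.inl ⟨s, h, h'.length_le.trans hu, Or.inl h'⟩
    · rcases sq z hz with ⟨s, h, -, h'⟩ | ⟨s, h, h', k⟩
      · exact Or.inl ⟨s, h, h'.length_le.trans hl.le,
          Or.inr (List.suffix_or_suffix_of_suffix h' hvl)⟩
      · exact Or.inr ⟨s, h, k.length_le.trans hl.le, h'⟩

theorem exists_visible_symm {V : Type*} {G : SimpleGraph V} {S : Set V} {x y : V}
    (h : ∃ p : G.Walk x y, p.length = G.dist x y ∧ ∀ z ∈ p.support, z ∈ S → z = x ∨ z = y) :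
    ∃ p : G.Walk y x, p.length = G.dist y x ∧ ∀ z ∈ p.support, z ∈ S → z = y ∨ z = x := by
  obtain ⟨p, hp, h⟩ := h
  refine ⟨p.reverse, by rw [Walk.length_reverse, hp, dist_comm], fun z hz hzS => ?_⟩
  rw [Walk.support_reverse, List.mem_reverse] at hz
  exact (h z hz hzS).symm

-- Colour classes.

/-- All vertices of depth `d` in one copy, and some vertices of the other copy `e`. -/
def levelSet (r : ℕ) (e : Bool) (d : ℕ) (E : Set (List (Fin t))) : Set (GluedTreeVertex r t) :=
  {z | (∃ w, w.length = d ∧ z = node r (!e) w) ∨ ∃ w ∈ E, z = node r e w}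

/-- Two vertices of the level see each other through shallower vertices of their copy. The extra
vertex, being shallower, reaches `v` by turning in its own copy and climbing from a leaf, which
meets the level only at `v`. -/
theorem isMutualVisibilitySet_levelSet (ht : 0 < t) (e : Bool) {d : ℕ} (hd : d ≤ r)
    {E : Set (List (Fin t))} (hE : ∀ w ∈ E, w.length < d) (hE' : E.Subsingleton) :
    IsMutualVisibilitySet (gluedTree r t) (levelSet r e d E) := by
  have opp : ∀ u ∈ E, ∀ v : List (Fin t), v.length = d →
      ∃ p : (gluedTree r t).Walk (node r e u) (node r (!e) v),
        p.length = (gluedTree r t).dist (node r e u) (node r (!e) v) ∧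
        ∀ z ∈ p.support, z ∈ levelSet r e d E → z = node r e u ∨ z = node r (!e) v := by
    intro u hu v hv
    have hud := hE u hu
    obtain ⟨p, hp, sp⟩ := exists_geodesic_opposite_sides (r := r) ht e (u := u) (v := v)
      (by omega) (by omega)
    refine ⟨p, hp, fun z hz hzS => ?_⟩
    rcases hzS with ⟨w, hw, rfl⟩ | ⟨w, hw, rfl⟩
    · right
      suffices w = v by rw [this]
      rcases sp _ hz with ⟨s, k, hsr, hs⟩ | ⟨s, k, hsr, hs⟩
      · have := (eq_of_node_eq_node (by omega) hsr k).1
        subst this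
        rcases hs with hs | hs | hs
        · have := hs.length_le
          omega
        · exact hs.eq_of_length (by omega)
        · exact (hs.eq_of_length (by omega)).symm
      · have := (eq_of_node_eq_node (by omega) hsr k).1
        subst this
        exact (hs.eq_of_length (by omega)).symm
    · left
      rw [hE' hw hu]
  rintro x (⟨u, hu, rfl⟩ | ⟨u, hu, rfl⟩) y (⟨v, hv, rfl⟩ | ⟨v, hv, rfl⟩)
  · obtain ⟨p, hp, sp⟩ := exists_geodesic_same_side (r := r) (!e) (u := u) (v := v)
      (by omega) (by omega)
    refine ⟨p, hp, fun z hz hzS => ?_⟩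
    obtain ⟨s, k, hsr, hs⟩ := sp z hz
    rcases hzS with ⟨w, hw, rfl⟩ | ⟨w, hw, rfl⟩
    · have := (eq_of_node_eq_node (by omega) hsr k).1
      subst this
      rcases hs with hs | hs
      · exact Or.inl (by rw [hs.eq_of_length (by omega)])
      · exact Or.inr (by rw [hs.eq_of_length (by omega)])
    · have hwd := hE w hw
      exact absurd k.symm (by
        simpa using node_ne_node_of_length_lt (b := !e) hsr (hwd.trans_le hd))
  · exact exists_visible_symm (opp v hv u hu)
  · exact opp u hu v hv
  · rw [hE' hu hv]
    exact ⟨Walk.nil, by simp, by simp⟩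

/-- Two sets of vertices of the same depth in the two copies. -/
def transversalSet (r : ℕ) (A : Bool → Set (List (Fin t))) : Set (GluedTreeVertex r t) :=
  {z | ∃ b, ∃ w ∈ A b, z = node r b w}

/-- Across the copies, both turns have the same length. Turning in one copy is blocked only by the
twin of the far end; if both turns were blocked, `A true ∩ A false` would contain two words. -/
theorem isMutualVisibilitySet_transversalSet (ht : 0 < t) {k : ℕ} (hk : k < r)
    {A : Bool → Set (List (Fin t))} (hA : ∀ b, ∀ w ∈ A b, w.length = k)
    (hA' : (A true ∩ A false).Subsingleton) :
    IsMutualVisibilitySet (gluedTree r t) (transversalSet r A) := by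
  have mem : ∀ {b s}, s.length ≤ r → node r b s ∈ transversalSet r A → s ∈ A b := by
    rintro b s hs ⟨c, w, hw, h⟩
    have hwk := hA c w hw
    obtain ⟨rfl, h⟩ := eq_of_node_eq_node hs (by omega) h
    obtain rfl := h.resolve_right (by omega)
    exact hw
  have opp : ∀ e, ∀ u ∈ A e, ∀ v ∈ A (!e), (v ∈ A e → u = v) →
      ∃ p : (gluedTree r t).Walk (node r e u) (node r (!e) v),
        p.length = (gluedTree r t).dist (node r e u) (node r (!e) v) ∧
        ∀ z ∈ p.support, z ∈ transversalSet r A → z = node r e u ∨ z = node r (!e) v := by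
    intro e u hu v hv huv
    have hu' := hA _ u hu
    have hv' := hA _ v hv
    obtain ⟨p, hp, sp⟩ := exists_geodesic_opposite_sides (r := r) ht e (u := u) (v := v)
      (by omega) (by omega)
    refine ⟨p, hp, fun z hz hzS => ?_⟩
    rcases sp _ hz with ⟨s, rfl, hsr, hs⟩ | ⟨s, rfl, hsr, hs⟩
    · left
      have hsA := mem hsr hzS
      have hs' := hA _ s hsA
      rcases hs with hs | hs | hs
      · rw [hs.eq_of_length (by omega)]
      · have := hs.eq_of_length (by omega)
        subst this
        rw [huv hsA]
      · have := hs.eq_of_length (by omega)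
        subst this
        rw [huv hsA]
    · right
      have hs' := hA _ s (mem hsr hzS)
      rw [hs.eq_of_length (by omega)]
  have cross : ∀ u ∈ A true, ∀ v ∈ A false,
      ∃ p : (gluedTree r t).Walk (node r true u) (node r false v),
        p.length = (gluedTree r t).dist (node r true u) (node r false v) ∧
        ∀ z ∈ p.support, z ∈ transversalSet r A → z = node r true u ∨ z = node r false v := by
    intro u hu v hv
    by_cases h : v ∈ A true → u = v
    · exact opp true u hu v hv h
    · push Not at h
      exact exists_visible_symm (opp false v hv u hu fun hu' =>
        absurd (hA' ⟨hu, hu'⟩ ⟨h.1, hv⟩) h.2)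
  have same : ∀ b, ∀ u ∈ A b, ∀ v ∈ A b,
      ∃ p : (gluedTree r t).Walk (node r b u) (node r b v),
        p.length = (gluedTree r t).dist (node r b u) (node r b v) ∧
        ∀ z ∈ p.support, z ∈ transversalSet r A → z = node r b u ∨ z = node r b v := by
    intro b u hu v hv
    have hu' := hA _ u hu
    have hv' := hA _ v hv
    obtain ⟨p, hp, sp⟩ := exists_geodesic_same_side (r := r) b (u := u) (v := v)
      (by omega) (by omega)
    refine ⟨p, hp, fun z hz hzS => ?_⟩
    obtain ⟨s, rfl, hsr, hs⟩ := sp z hz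
    have hs' := hA _ s (mem hsr hzS)
    rcases hs with hs | hs
    · exact Or.inl (by rw [hs.eq_of_length (by omega)])
    · exact Or.inr (by rw [hs.eq_of_length (by omega)])
  rintro x ⟨b, u, hu, rfl⟩ y ⟨c, v, hv, rfl⟩
  cases b <;> cases c
  · exact same _ u hu v hv
  · exact exists_visible_symm (cross v hv u hu)
  · exact cross u hu v hv
  · exact same _ u hu v hv

-- Colourings.

/-- Covers suffice, because subsets of mutual-visibility sets are mutual-visibility sets. -/
theorem colorable_of_cover {V ι : Type*} [Fintype ι] {G : SimpleGraph V} (C : ι → Set V)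
    (hC : ∀ i, IsMutualVisibilitySet G (C i)) (h : ∀ v, ∃ i, v ∈ C i) {n : ℕ}
    (hn : Fintype.card ι = n) : MutualVisibilityColorable G n := by
  choose f hf using h
  refine ⟨fun v => Fintype.equivFinOfCardEq hn (f v), fun a x hx y hy => ?_⟩
  have mem : ∀ v, Fintype.equivFinOfCardEq hn (f v) = a →
      v ∈ C ((Fintype.equivFinOfCardEq hn).symm a) := by
    rintro v rfl
    rw [Equiv.symm_apply_apply]
    exact hf v
  obtain ⟨p, hp, sp⟩ := hC _ x (mem x hx) y (mem y hy)
  exact ⟨p, hp, fun z hz hza => sp z hz (mem z hza)⟩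

theorem exists_injOn_lt {α : Type*} (X : Finset α) {n : ℕ} (h : X.card ≤ n) :
    ∃ g : α → ℕ, Set.InjOn g X ∧ ∀ x ∈ X, g x < n := by
  classical
  refine ⟨fun x => if hx : x ∈ X then X.equivFin ⟨x, hx⟩ else 0, fun x hx y hy e => ?_,
    fun x hx => ?_⟩
  · rw [Finset.mem_coe] at hx hy
    dsimp only at e
    rw [dif_pos hx, dif_pos hy] at e
    exact congrArg Subtype.val (X.equivFin.injective (Fin.ext e))
  · dsimp only
    rw [dif_pos hx]
    exact (Fin.is_lt _).trans_le h

/-- The levels of depth at least `K`, together with one further vertex for each of them. -/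
theorem exists_level_cover (ht : 0 < t) {K : ℕ} (hK : K ≤ r) (X : Bool → Finset (List (Fin t)))
    (hX : ∀ b, ∀ w ∈ X b, w.length < K) (h₁ : (X true).card ≤ r - K)
    (h₂ : (X false).card ≤ r - K + 1) :
    ∃ C : Option (Bool × Fin (r - K)) → Set (GluedTreeVertex r t),
      (∀ i, IsMutualVisibilitySet (gluedTree r t) (C i)) ∧
      ∀ b w, w.length ≤ r → K ≤ w.length ∨ w ∈ X b → ∃ i, node r b w ∈ C i := by
  -- Each copy has `r - K` slots, on the non-leaf levels of the other copy. The leaf class, indexed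
  -- by `none`, supplies one more slot, given to the copy `false`.
  have hg : ∀ b, ∃ g : List (Fin t) → ℕ, Set.InjOn g (X b) ∧
      ∀ x ∈ X b, g x < r - K + if b then 0 else 1 := by
    intro b
    cases b
    · exact exists_injOn_lt _ h₂
    · exact exists_injOn_lt _ h₁
  choose g hg hg' using hg
  have ss : ∀ b (j : ℕ), {w | w ∈ X b ∧ g b w = j}.Subsingleton := fun b j x hx y hy =>
    hg b hx.1 hy.1 (hx.2.trans hy.2.symm)
  refine ⟨fun o => o.elim (levelSet r false r {w | w ∈ X false ∧ g false w = r - K})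
    fun i => levelSet r i.1 (K + i.2) {w | w ∈ X i.1 ∧ g i.1 w = i.2}, ?_, ?_⟩
  · rintro (_ | ⟨b, j⟩)
    · exact isMutualVisibilitySet_levelSet ht _ le_rfl
        (fun w hw => (hX _ w hw.1).trans_le hK) (ss _ _)
    · exact isMutualVisibilitySet_levelSet ht _ (by have := j.2; omega)
        (fun w hw => (hX _ w hw.1).trans_le (Nat.le_add_right _ _)) (ss _ _)
  · rintro b w hwr (hw | hw)
    · rcases hwr.lt_or_eq with h | h
      · refine ⟨some (!b, ⟨w.length - K, by omega⟩), Or.inl ⟨w, ?_, ?_⟩⟩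
        · dsimp only; omega
        · rw [Bool.not_not]
      · exact ⟨none, Or.inl ⟨w, h, node_eq_node_of_length_eq _ _ h⟩⟩
    · by_cases hj : g b w < r - K
      · exact ⟨some (b, ⟨g b w, hj⟩), Or.inr ⟨w, ⟨hw, rfl⟩, rfl⟩⟩
      · have := hg' b w hw
        cases b
        · refine ⟨none, Or.inr ⟨w, ⟨hw, ?_⟩, rfl⟩⟩
          simp only [Bool.false_eq_true, if_false] at this
          omega
        · exact absurd (by simpa using this) hj

/-- The words of length `d`. -/
def words (t d : ℕ) : Finset (List (Fin t)) :=
  (Finset.univ : Finset (List.Vector (Fin t) d)).map 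
    ⟨List.Vector.toList, fun _ _ h => Subtype.ext h⟩

theorem mem_words {d : ℕ} {w : List (Fin t)} : w ∈ words t d ↔ w.length = d := by
  constructor
  · intro h
    obtain ⟨l, -, rfl⟩ := Finset.mem_map.1 h
    exact l.2
  · intro h
    exact Finset.mem_map.2 ⟨⟨w, h⟩, Finset.mem_univ _, rfl⟩

theorem card_words (d : ℕ) : (words t d).card = t ^ d := by
  rw [words, Finset.card_map, Finset.card_univ, card_vector, Fintype.card_fin]

/-- The words of length less than `k`. -/
def shortWords (t k : ℕ) : Finset (List (Fin t)) := (Finset.range k).biUnion (words t)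

theorem mem_shortWords {k : ℕ} {w : List (Fin t)} : w ∈ shortWords t k ↔ w.length < k := by
  simp [shortWords, mem_words]

theorem card_shortWords_le (k : ℕ) :
    (shortWords t k).card ≤ ∑ d ∈ Finset.range k, t ^ d := by
  refine Finset.card_biUnion_le.trans (Finset.sum_le_sum fun d _ => ?_)
  rw [card_words]

theorem colorable_odd (ht : 0 < t) {k : ℕ} (h : ∑ d ∈ Finset.range k, t ^ d + k ≤ r) :
    MutualVisibilityColorable (gluedTree r t) (2 * (r - k) + 1) := by
  have hc := card_shortWords_le (t := t) k
  obtain ⟨C, hC, hC'⟩ := exists_level_cover (r := r) ht (K := k) (by omega)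
    (fun _ => shortWords t k) (fun _ w hw => mem_shortWords.1 hw) (by omega) (by omega)
  refine colorable_of_cover C hC (fun v => ?_) (by simp)
  obtain ⟨b, hb⟩ := exists_eq_node v
  rw [hb]
  refine hC' _ _ (length_word_le v) ?_
  rw [mem_shortWords]
  exact le_or_gt _ _

theorem colorable_even (ht : 2 ≤ t) {k : ℕ} (hk : 1 ≤ k) (hkr : k < r)
    (h : 2 * (∑ d ∈ Finset.range k, t ^ d) + t ^ k + 2 * k ≤ 2 * r)
    (h' : r ≤ ∑ d ∈ Finset.range k, t ^ d + t ^ k + k) :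
    MutualVisibilityColorable (gluedTree r t) (2 * (r - k)) := by
  classical
  have ht' : 0 < t := by omega
  have hc := card_shortWords_le (t := t) k
  generalize ∑ d ∈ Finset.range k, t ^ d = T at h h' hc
  have hP : 2 ≤ t ^ k := ht.trans (Nat.le_self_pow (by omega) t)
  -- The size of `A` makes the extra vertices of copy `true`, at most `T + t ^ k - A.card` of them,
  -- just fit their `r - (k + 1)` slots. The bound `h'` makes `A` nonempty, and `h` makes the extra
  -- vertices of copy `false` fit.
  obtain ⟨A, hA, hAc⟩ := Finset.exists_subset_card_eq
    (s := words t k) (n := T + t ^ k - (r - (k + 1))) (by rw [card_words]; omega)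
  obtain ⟨w₀, hw₀⟩ : A.Nonempty := Finset.card_pos.1 (by omega)
  -- The two parts cover all words of length `k` and share only `w₀`, the one overlap that a
  -- transversal class allows.
  let D : Bool → Finset (List (Fin t)) := fun b => if b then A else insert w₀ (words t k \ A)
  have hD : ∀ b, ∀ w ∈ D b, w.length = k := by
    rintro (_ | _) w hw
    · rcases Finset.mem_insert.1 hw with rfl | hw
      · exact mem_words.1 (hA hw₀)
      · exact mem_words.1 (Finset.mem_sdiff.1 hw).1
    · exact mem_words.1 (hA hw)
  have hX₁ : (words t k \ D true).card ≤ t ^ k - A.card := by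
    rw [← card_words (t := t) k]
    exact (Finset.card_sdiff_of_subset hA).le
  have hX₂ : (words t k \ D false).card ≤ A.card - 1 := by
    rw [← Finset.card_erase_of_mem hw₀]
    refine Finset.card_le_card fun w hw => ?_
    obtain ⟨h₁, h₂⟩ := Finset.mem_sdiff.1 hw
    rw [Finset.mem_erase]
    refine ⟨fun e => h₂ (Finset.mem_insert.2 (Or.inl e)), ?_⟩
    by_contra hwA
    exact h₂ (Finset.mem_insert.2 (Or.inr (Finset.mem_sdiff.2 ⟨h₁, hwA⟩)))
  obtain ⟨C, hC, hC'⟩ := exists_level_cover (r := r) ht' (K := k + 1) (by omega)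
    (fun b => shortWords t k ∪ (words t k \ D b))
    (by
      intro b w hw
      rcases Finset.mem_union.1 hw with hw | hw
      · have := mem_shortWords.1 hw
        omega
      · have := mem_words.1 (Finset.mem_sdiff.1 hw).1
        omega)
    ((Finset.card_union_le _ _).trans (by omega)) ((Finset.card_union_le _ _).trans (by omega))
  refine colorable_of_cover
    (fun o : Option (Option (Bool × Fin (r - (k + 1)))) => o.elim (transversalSet r fun b => D b) C)
    ?_ (fun v => ?_) (by simp; omega)
  · rintro (_ | i)
    · refine isMutualVisibilitySet_transversalSet ht' hkr hD ?_
      have : ∀ x ∈ (D true : Set (List (Fin t))) ∩ D false, x = w₀ := by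
        rintro x ⟨h₁, h₂⟩
        exact (Finset.mem_insert.1 h₂).resolve_right fun h => (Finset.mem_sdiff.1 h).2 h₁
      exact fun x hx y hy => (this x hx).trans (this y hy).symm
    · exact hC i
  · obtain ⟨b, hb⟩ := exists_eq_node v
    rw [hb]
    by_cases hw : word v ∈ D b
    · exact ⟨none, b, _, hw, rfl⟩
    · obtain ⟨i, hi⟩ := hC' b (word v) (length_word_le v) (by
        rw [Finset.mem_union, Finset.mem_sdiff, mem_shortWords, mem_words]
        rcases lt_trichotomy (word v).length k with h | h | h
        · exact Or.inr (Or.inl h)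
        · exact Or.inr (Or.inr ⟨h, hw⟩)
        · exact Or.inl h)
      exact ⟨some i, hi⟩

-- The chromatic number in the two ranges.

theorem mutualVisibilityChromaticNumber_eq {V : Type*} [Finite V] {G : SimpleGraph V} {n : ℕ}
    (h : MutualVisibilityColorable G n) (h' : ∀ m, MutualVisibilityColorable G m → n ≤ m) :
    mutualVisibilityChromaticNumber G = n :=
  le_antisymm (Nat.sInf_le h) (le_csInf ⟨n, h⟩ h')

theorem mutualVisibilityChromaticNumber_odd (ht : 2 ≤ t) {k : ℕ} (hk : 1 ≤ k)
    (h : ∑ d ∈ Finset.range k, t ^ d + k ≤ r)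
    (h' : 2 * r + 2 ≤ 2 * (∑ d ∈ Finset.range k, t ^ d) + t ^ k + 2 * k) :
    mutualVisibilityChromaticNumber (gluedTree r t) = 2 * (r - k) + 1 := by
  refine mutualVisibilityChromaticNumber_eq (colorable_odd (by omega) h) fun n hn => ?_
  have := le_of_colorable ht hk (by omega) hn
  by_contra hcon
  -- With at most `2 * (r - k)` colours, `le_of_colorable` would give 2T + t^k ≤ 2(r-k), against
  -- `h'`.
  have h₁ : n * (t ^ k + 1) ≤ 2 * (r - k) * (t ^ k + 1) := Nat.mul_le_mul_right _ (by omega)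
  have h₂ : (2 * (r - k) + 1) * t ^ k = 2 * (r - k) * t ^ k + t ^ k := by ring
  rw [mul_add (2 * (r - k)), mul_one] at h₁
  omega

theorem mutualVisibilityChromaticNumber_even (ht : 2 ≤ t) {k : ℕ} (hk : 1 ≤ k)
    (h : 2 * (∑ d ∈ Finset.range k, t ^ d) + t ^ k + 2 * k ≤ 2 * r)
    (h' : r ≤ ∑ d ∈ Finset.range k, t ^ d + t ^ k + k) :
    mutualVisibilityChromaticNumber (gluedTree r t) = 2 * (r - k) := by
  have hP : 0 < t ^ k := Nat.pow_pos (by omega)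
  refine mutualVisibilityChromaticNumber_eq (colorable_even ht hk (by omega) h h') fun n hn => ?_
  have := le_of_colorable ht hk (by omega) hn
  by_contra hcon
  -- One colour fewer would give 2T + 2t^k + 1 ≤ 2(r-k), against `h'`.
  have h₁ : (n + 1) * (t ^ k + 1) ≤ 2 * (r - k) * (t ^ k + 1) := Nat.mul_le_mul_right _ (by omega)
  have h₂ : (2 * (r - k) + 1) * t ^ k = 2 * (r - k) * t ^ k + t ^ k := by ring
  rw [mul_add (2 * (r - k)), mul_one, add_mul, one_mul] at h₁
  omega

end GluedTree

open GluedTree in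
theorem mainTheorem3 (r t : ℕ) (hr : 2 ≤ r) (ht : 2 ≤ t) (i : ℕ) (hi : 1 ≤ i) :
    (((t : ℝ) ^ (i - 1) - 1) / ((t : ℝ) - 1) + (i : ℝ) - 1 ≤ (r : ℝ) ∧
        (r : ℝ) ≤ ((t : ℝ) ^ (i - 1) - 1) / ((t : ℝ) - 1) + (t : ℝ) ^ (i - 1) / 2 + (i : ℝ) - 2 →
      (mutualVisibilityChromaticNumber (gluedTree r t) : ℤ) = 2 * ((r : ℤ) - (i : ℤ)) + 3) ∧
    (((t : ℝ) ^ (i - 1) - 1) / ((t : ℝ) - 1) + (t : ℝ) ^ (i - 1) / 2 + (i : ℝ) - 1 ≤ (r : ℝ) ∧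
        (r : ℝ) ≤ ((t : ℝ) ^ i - 1) / ((t : ℝ) - 1) + (i : ℝ) - 1 →
      (mutualVisibilityChromaticNumber (gluedTree r t) : ℤ) = 2 * ((r : ℤ) - (i : ℤ)) + 2) := by
  obtain ⟨k, rfl⟩ := Nat.exists_eq_add_of_le' hi
  have ht₁ : (t : ℝ) ≠ 1 := by exact_mod_cast (by omega : t ≠ 1)
  have geom : ∀ n, ((t : ℝ) ^ n - 1) / ((t : ℝ) - 1) = ((∑ d ∈ Finset.range n, t ^ d : ℕ) : ℝ) := by
    intro n
    rw [← geom_sum_eq ht₁]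
    push_cast
    rfl
  rw [Nat.add_sub_cancel, geom, geom, Finset.sum_range_succ]
  -- For `k = 0` both ranges would force `r ≤ 1`; this provides the hypothesis `1 ≤ k` below.
  have hT : k = 0 → ∑ d ∈ Finset.range k, t ^ d = 0 ∧ t ^ k = 1 := by
    rintro rfl
    simp
  constructor
  · rintro ⟨h₁, h₂⟩
    have h₁' : ∑ d ∈ Finset.range k, t ^ d + k ≤ r := by
      have : ((∑ d ∈ Finset.range k, t ^ d : ℕ) : ℝ) + k ≤ r := by push_cast at h₁ ⊢; linarith
      exact_mod_cast this
    have h₂' : 2 * r + 2 ≤ 2 * (∑ d ∈ Finset.range k, t ^ d) + t ^ k + 2 * k := by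
      have : 2 * (r : ℝ) + 2 ≤ 2 * ((∑ d ∈ Finset.range k, t ^ d : ℕ) : ℝ) + (t : ℝ) ^ k + 2 * k := by
        push_cast at h₂ ⊢; linarith
      exact_mod_cast this
    rw [mutualVisibilityChromaticNumber_odd ht (by omega) h₁' h₂']
    omega
  · rintro ⟨h₁, h₂⟩
    have h₁' : 2 * (∑ d ∈ Finset.range k, t ^ d) + t ^ k + 2 * k ≤ 2 * r := by
      have : 2 * ((∑ d ∈ Finset.range k, t ^ d : ℕ) : ℝ) + (t : ℝ) ^ k + 2 * k ≤ 2 * (r : ℝ) := by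
        push_cast at h₁ ⊢; linarith
      exact_mod_cast this
    have h₂' : r ≤ ∑ d ∈ Finset.range k, t ^ d + t ^ k + k := by
      have : (r : ℝ) ≤ ((∑ d ∈ Finset.range k, t ^ d + t ^ k : ℕ) : ℝ) + k := by
        push_cast at h₂ ⊢; linarith
      exact_mod_cast this
    rw [mutualVisibilityChromaticNumber_even ht (by omega) h₁' h₂']
    omega
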